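/- Let $g=(V,E)$ be a decomposable undirected graph on a finite vertex set $V$ with $|V|=p$: that is, $g$ is complete, or $V$ is a disjoint union $A\cup B\cup C$ with $A,B\neq\emptyset$, $C$ complete and separating $A$ from $B$, such that the subgraphs induced by $A\cup C$ and by $B\cup C$ are decomposable. Let $C_1,\dots,C_k$ be a perfect sequence of the cliques (the maximal complete subsets) of $g$, each listed once: with separators $S_j=(C_1\cup\dots\cup C_{j-1})\cap C_j$ for $j=2,\dots,k$, each $S_j$ is complete and is contained in $C_l$ for some $l<j$. Let $M^+(g)$ be the set of positive definite $p\times p$ matrices $\Omega$ with $\Omega_{ij}=0$ whenever $i\ne j$ and $(i,j)\notin E$. For $\delta>0$ and $\Phi$ positive definite, let $W(g,\delta,\Phi)$ denote the Wishart distribution constrained to $g$, that is, the distribution on $M^+(g)$ whose density, with respect to Lebesgue measure on the free entries of $\Omega$ (the diagonal entries and one entry for each edge), is proportional to $$|\Omega|^{(\delta-2)/2}\exp\left(-\tfrac12\operatorname{tr}(\Omega\Phi)\right).$$ For a $B\times B$ matrix $A$ with $B\subseteq V$, let $[A]^V$ be the $p\times p$ matrix that agrees with $A$ on $B\times B$ and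 is zero elsewhere; let $\Phi_{BB}$ be the submatrix of $\Phi$ with rows and columns in $B$. Suppose that, given the data $y$ (and the parameters $\delta,\Phi,g$), the random matrix $\Omega$ has posterior distribution $W(g,\delta^*,\Phi^*)$, where $\delta^*>0$ and $\Phi^*$ is positive definite. Then this posterior is a proper probability distribution, every entry of $\Omega$ is integrable under it, and the posterior mean is $$E(\Omega\mid y,\delta,\Phi,g)=\sum_{i=1}^k\left[(\delta^*+|C_i|-1)\,(\Phi^*_{C_iC_i})^{-1}\right]^V-\sum_{i=2}^k\left[(\delta^*+|S_i|-1)\,(\Phi^*_{S_iS_i})^{-1}\right]^V .$$ -/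

import Mathlib

open MeasureTheory

/-! Decomposable graphs, perfect sequences of cliques, and the Wishart law constrained to a graph.
The vertex set `V` is an arbitrary finite type. -/

/-- Measurability of matrices is entrywise (the product σ-algebra). -/
instance matrixMeasurableSpace {m n : Type*} : MeasurableSpace (Matrix m n ℝ) :=
  MeasurableSpace.pi

/-- `C` separates `A` from `B` in the subgraph of `g` induced by `A ∪ B ∪ C`: every walk inside
`A ∪ B ∪ C` from a vertex of `A` to a vertex of `B` meets `C`. -/
def Separates {V : Type*} [DecidableEq V] (g : SimpleGraph V) (A B C : Finset V) : Prop :=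
  ∀ a ∈ A, ∀ b ∈ B, ∀ w : g.Walk a b,
    (∀ v ∈ w.support, v ∈ A ∪ B ∪ C) → ∃ v ∈ w.support, v ∈ C

/-- Decomposability of the subgraph of `g` induced by a set of vertices: it is complete, or it has
a proper decomposition `(A, B, C)` (disjoint sets covering its vertices, `A` and `B` nonempty,
`C` complete and separating `A` from `B`) such that the subgraphs induced by `A ∪ C` and by
`B ∪ C` are decomposable. -/
inductive DecomposableOn {V : Type*} [DecidableEq V] (g : SimpleGraph V) : Finset V → Prop
  | complete (s : Finset V) (hs : g.IsClique (s : Set V)) : DecomposableOn g s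
  | decomposition (A B C : Finset V) (hAB : Disjoint A B) (hAC : Disjoint A C)
      (hBC : Disjoint B C) (hA : A.Nonempty) (hB : B.Nonempty)
      (hC : g.IsClique (C : Set V)) (hsep : Separates g A B C)
      (h₁ : DecomposableOn g (A ∪ C)) (h₂ : DecomposableOn g (B ∪ C)) :
      DecomposableOn g (A ∪ B ∪ C)

/-- A decomposable graph. -/
def Decomposable {V : Type*} [Fintype V] [DecidableEq V] (g : SimpleGraph V) : Prop :=
  DecomposableOn g Finset.univ

/-- The part of the `j`-th set that lies in the union of the earlier ones; for every `j` but the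
first this is the separator `S_j = (C_1 ∪ ⋯ ∪ C_{j-1}) ∩ C_j`. -/
def separator {V : Type*} [DecidableEq V] {k : ℕ} (C : Fin k → Finset V) (j : Fin k) : Finset V :=
  ((Finset.univ.filter (fun l : Fin k => l < j)).biUnion C) ∩ C j

/-- `C` lists the cliques (the maximal complete sets) of `g`, each exactly once, in a perfect
sequence: every separator is complete and is contained in one of the earlier cliques. -/
structure IsPerfectCliqueSequence {V : Type*} [DecidableEq V] (g : SimpleGraph V) {k : ℕ}
    (C : Fin k → Finset V) : Prop where
  injective : Function.Injective C
  mem_range_iff : ∀ s : Finset V,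
    s ∈ Set.range C ↔ Maximal (fun t : Finset V => g.IsClique (t : Set V)) s
  separator_complete : ∀ j : Fin k, 0 < j.val → g.IsClique (separator C j : Set V)
  separator_subset : ∀ j : Fin k, 0 < j.val → ∃ l : Fin k, l < j ∧ separator C j ⊆ C l

/-- The block `A_{BB}` of a matrix. -/
def block {V : Type*} (A : Matrix V V ℝ) (B : Finset V) : Matrix B B ℝ :=
  A.submatrix Subtype.val Subtype.val

/-- `[A]^V`: a matrix indexed by a subset `B` of `V`, extended by zeros to a matrix indexed
by `V`. -/
def pad {V : Type*} [DecidableEq V] {B : Finset V} (A : Matrix B B ℝ) : Matrix V V ℝ :=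
  Matrix.of fun i j => if h : i ∈ B ∧ j ∈ B then A ⟨i, h.1⟩ ⟨j, h.2⟩ else 0

open Classical in
/-- The symmetric matrix with given diagonal entries `x (inl i)`, given entries `x (inr e)` at the
edges `e` of `g`, and zeros elsewhere. -/
noncomputable def graphMatrix {V : Type*} (g : SimpleGraph V) (x : V ⊕ g.edgeSet → ℝ) :
    Matrix V V ℝ :=
  Matrix.of fun i j =>
    if i = j then x (Sum.inl i)
    else if h : g.Adj i j then x (Sum.inr ⟨s(i, j), (g.mem_edgeSet).2 h⟩)
    else 0

/-- The unnormalized density `|Ω|^((δ - 2) / 2) exp (- tr (Ω Φ) / 2)` on the cone `M⁺(g)` of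
positive definite matrices that vanish off the diagonal and the edges of `g`, as a function of the
free entries of `Ω` (the diagonal entries and one entry for each edge). -/
noncomputable def graphWishartDensity {V : Type*} [Fintype V] [DecidableEq V] (g : SimpleGraph V)
    (δ : ℝ) (Φ : Matrix V V ℝ) : (V ⊕ g.edgeSet → ℝ) → ENNReal :=
  Set.indicator {x | (graphMatrix g x).PosDef} fun x =>
    ENNReal.ofReal ((graphMatrix g x).det ^ ((δ - 2) / 2) *
      Real.exp (-(1 / 2) * (graphMatrix g x * Φ).trace))

open Classical in
/-- The Wishart law `W(g, δ, Φ)` constrained to the graph `g`: the law on matrices whose density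
with respect to Lebesgue measure on the free entries is proportional to `graphWishartDensity`. -/
noncomputable def graphWishart {V : Type*} [Fintype V] [DecidableEq V] (g : SimpleGraph V)
    (δ : ℝ) (Φ : Matrix V V ℝ) : Measure (Matrix V V ℝ) :=
  (∫⁻ x, graphWishartDensity g δ Φ x)⁻¹ •
    ((volume : Measure (V ⊕ g.edgeSet → ℝ)).withDensity (graphWishartDensity g δ Φ)).map
      (graphMatrix g)

/-! The cliques of a perfect sequence allow the vertices to be added one at a time so that each new
vertex `v` is simplicial: its neighbours `N` among the vertices `W` already present form a clique.
The matrix on `insert v W` then splits as `ω u uᵀ + M`, where `u` is `1` at `v` and `b` on `N`, and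
`M` is supported on `W × W` with the pattern of the graph (it is the Schur complement of the pivot
`ω`). The determinant becomes `ω |M|`, positivity becomes `ω > 0` together with positivity of `M`,
the trace is additive, and passing from the edge entries `ω b` to `b` costs a Jacobian `ω ^ |N|`.
The weight therefore factors (`blockIntegral_insert`), and the factor of `M` is the same weight on
`W`, with the same `δ` and `Φ`.

In the factor of `v`, completing the square in `b` (`starVec_quadratic`) leaves `ω` with a Gamma law
and `b`, given `ω`, Gaussian about the regression vector, with covariance `(ω Φ_NN)⁻¹`. With `φ` the
residual of `v` on `N` and `u₀` the value of `u` at the regression vector, the mean of `ω u uᵀ` is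
`((δ + |N|) / φ) u₀ u₀ᵀ` plus the padded `Φ_NN⁻¹`. By the formula for a bordered inverse
(`pad_inv_block_insert`) this is `cliqueTerm` of `insert v N` minus `cliqueTerm` of `N`
(`exists_starLaw`).

Adding the vertices of `C j` that are not in earlier cliques, starting from its separator, makes
these differences telescope to the term of `C j` minus the term of the separator
(`HasBlockLaw.add_clique`). Summing over `j` gives the formula. The same induction shows that the
total mass is positive and finite and that the entries are integrable. -/

/-! ### Product densities and moments of the standard Gaussian vector. -/

/-- Tonelli's theorem for a product of functions of one coordinate each. -/
theorem lintegral_fintype_prod {ι : Type*} [Fintype ι] (g : ι → ℝ → ENNReal)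
    (hg : ∀ i, Measurable (g i)) :
    ∫⁻ x : ι → ℝ, ∏ i, g i (x i) = ∏ i, ∫⁻ t, g i t := by
  classical
  -- Partial integrals over arbitrary sets of coordinates make an induction on one coordinate
  -- possible.
  have key : ∀ s : Finset ι, ∀ x : ι → ℝ,
      lmarginal (fun _ : ι => (volume : Measure ℝ)) s (fun x => ∏ i ∈ s, g i (x i)) x
        = ∏ i ∈ s, ∫⁻ t, g i t := by
    intro s
    induction s using Finset.induction with
    | empty => intro x; simp
    | insert a s ha ih =>
      intro x
      have hm : Measurable fun x : ι → ℝ => ∏ i ∈ insert a s, g i (x i) :=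
        Finset.measurable_prod _ fun i _ => (hg i).comp (measurable_pi_apply i)
      rw [lmarginal_insert _ hm ha, Finset.prod_insert ha, ← lintegral_mul_const _ (hg a)]
      refine lintegral_congr fun t => ?_
      rw [← ih (Function.update x a t), lmarginal, lmarginal, ← lintegral_const_mul]
      · refine lintegral_congr fun y => ?_
        rw [Finset.prod_insert ha]
        simp [Function.updateFinset, ha]
      · refine Finset.measurable_prod _ fun i _ => (hg i).comp ?_
        exact (measurable_pi_apply (X := fun _ : ι => ℝ) i).comp measurable_updateFinset
  have := key Finset.univ 0
  rw [lmarginal_univ] at this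
  exact this

theorem pi_withDensity_volume {ι : Type*} [Fintype ι] (g : ι → ℝ → ENNReal)
    (hg : ∀ i, Measurable (g i)) [∀ i, SigmaFinite ((volume : Measure ℝ).withDensity (g i))] :
    Measure.pi (fun i => (volume : Measure ℝ).withDensity (g i)) =
      (volume : Measure (ι → ℝ)).withDensity fun x => ∏ i, g i (x i) := by
  refine Measure.pi_eq fun s hs => ?_
  rw [withDensity_apply _ (MeasurableSet.univ_pi hs), ← lintegral_indicator
    (MeasurableSet.univ_pi hs)]
  have h1 : ∀ i, (volume : Measure ℝ).withDensity (g i) (s i) =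
      ∫⁻ t, (s i).indicator (g i) t := fun i => by
    rw [withDensity_apply _ (hs i), lintegral_indicator (hs i)]
  simp only [h1]
  rw [← lintegral_fintype_prod _ fun i => (hg i).indicator (hs i)]
  refine lintegral_congr fun x => ?_
  by_cases hx : x ∈ Set.univ.pi s
  · rw [Set.indicator_of_mem hx]
    exact Finset.prod_congr rfl fun i _ => by rw [Set.indicator_of_mem (hx i trivial)]
  · rw [Set.indicator_of_notMem hx]
    simp only [Set.mem_pi, not_forall] at hx
    obtain ⟨i, _, hi⟩ := hx
    exact (Finset.prod_eq_zero (Finset.mem_univ i) (Set.indicator_of_notMem hi _)).symm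

open ProbabilityTheory

theorem pi_gaussianReal_eq_withDensity (ι : Type*) [Fintype ι] :
    Measure.pi (fun _ : ι => gaussianReal 0 1) =
      (volume : Measure (ι → ℝ)).withDensity fun x =>
        ENNReal.ofReal (((√(2 * Real.pi))⁻¹) ^ Fintype.card ι *
          Real.exp (-(1 / 2) * (x ⬝ᵥ x))) := by
  have h1 : gaussianReal 0 1 = (volume : Measure ℝ).withDensity (gaussianPDF 0 1) :=
    gaussianReal_of_var_ne_zero 0 one_ne_zero
  have : SigmaFinite ((volume : Measure ℝ).withDensity (gaussianPDF 0 1)) := by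
    rw [← h1]; infer_instance
  rw [h1, pi_withDensity_volume _ fun _ => measurable_gaussianPDF 0 1]
  congr 1
  funext x
  simp only [gaussianPDF]
  rw [← ENNReal.ofReal_prod_of_nonneg fun i _ => gaussianPDFReal_nonneg 0 1 _]
  congr 1
  simp only [gaussianPDFReal, Finset.prod_mul_distrib, Finset.prod_const, Finset.card_univ,
    ← Real.exp_sum]
  congr 2
  · simp
  · simp only [dotProduct, Finset.mul_sum]
    refine Finset.sum_congr rfl fun i _ => ?_
    simp; ring

section moments

variable {ι : Type*} [Fintype ι]

theorem integrable_eval_pi_gaussian (i : ι) :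
    Integrable (fun z : ι → ℝ => z i) (Measure.pi fun _ : ι => gaussianReal 0 1) :=
  integrable_eval (memLp_one_iff_integrable.1 (memLp_id_gaussianReal 1))

theorem integral_eval_pi_gaussian (i : ι) :
    ∫ z : ι → ℝ, z i ∂(Measure.pi fun _ : ι => gaussianReal 0 1) = 0 := by
  rw [integral_comp_eval (μ := fun _ : ι => gaussianReal 0 1) (f := fun t : ℝ => t)
    (by fun_prop)]
  simp

theorem memLp_eval_pi_gaussian (i : ι) :
    MemLp (fun z : ι → ℝ => z i) 2 (Measure.pi fun _ : ι => gaussianReal 0 1) :=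
  (memLp_id_gaussianReal 2).comp_measurePreserving (measurePreserving_eval _ i)

theorem integrable_eval_mul_eval_pi_gaussian (i j : ι) :
    Integrable (fun z : ι → ℝ => z i * z j) (Measure.pi fun _ : ι => gaussianReal 0 1) :=
  (memLp_eval_pi_gaussian i).integrable_mul (memLp_eval_pi_gaussian j)

theorem integral_eval_mul_eval_pi_gaussian [DecidableEq ι] (i j : ι) :
    ∫ z : ι → ℝ, z i * z j ∂(Measure.pi fun _ : ι => gaussianReal 0 1) =
      if i = j then 1 else 0 := by
  split_ifs with h
  · subst h
    rw [integral_comp_eval (μ := fun _ : ι => gaussianReal 0 1) (f := fun t : ℝ => t * t)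
      (by fun_prop)]
    have := variance_fun_id_gaussianReal (μ := 0) (v := 1)
    rw [variance_eq_integral (by fun_prop)] at this
    simpa [pow_two] using this
  · have h1 : IndepFun (fun z : ι → ℝ => z i) (fun z : ι → ℝ => z j)
        (Measure.pi fun _ : ι => gaussianReal 0 1) :=
      (iIndepFun_pi (μ := fun _ : ι => gaussianReal 0 1) (X := fun _ => id)
        fun _ => aemeasurable_id).indepFun h
    rw [h1.integral_fun_mul_eq_mul_integral
      (measurable_pi_apply i).aestronglyMeasurable (measurable_pi_apply j).aestronglyMeasurable,
      integral_eval_pi_gaussian, zero_mul]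

end moments

/-! ### The Gamma law and its mean. -/

section gamma

variable {a r : ℝ}

theorem gammaMeasure_Iic_zero : gammaMeasure a r (Set.Iic 0) = 0 := by
  rw [gammaMeasure, withDensity_apply _ measurableSet_Iic, setLIntegral_congr Iio_ae_eq_Iic.symm]
  exact lintegral_gammaPDF_of_nonpos le_rfl

theorem ae_pos_gammaMeasure : ∀ᵐ x ∂gammaMeasure a r, 0 < x := by
  rw [ae_iff]
  simpa [← Set.Iic_def] using gammaMeasure_Iic_zero (a := a) (r := r)

theorem lintegral_gammaMeasure {f : ℝ → ENNReal} (hf : Measurable f) :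
    ∫⁻ x, f x ∂gammaMeasure a r = ∫⁻ x in Set.Ioi 0,
      ENNReal.ofReal (r ^ a / Real.Gamma a * x ^ (a - 1) * Real.exp (-(r * x))) * f x := by
  have hm : Measurable (gammaPDF a r) := (measurable_gammaPDFReal a r).ennreal_ofReal
  rw [gammaMeasure, lintegral_withDensity_eq_lintegral_mul _ hm hf,
    ← lintegral_add_compl _ (measurableSet_Ioi (a := (0 : ℝ))), Set.compl_Ioi,
    setLIntegral_congr Iio_ae_eq_Iic.symm]
  rw [setLIntegral_congr_fun (g := fun _ => 0) measurableSet_Iio, lintegral_zero, add_zero]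
  · refine setLIntegral_congr_fun measurableSet_Ioi fun x hx => ?_
    simp only [Pi.mul_apply, gammaPDF_of_nonneg (le_of_lt hx)]
  · intro x hx
    simp [gammaPDF_of_neg hx]

/-- Multiplying the density of shape `a` by `x` gives `a / r` times the density of shape `a + 1`,
whose total mass is one. -/
theorem integrable_id_gammaMeasure_and_integral (ha : 0 < a) (hr : 0 < r) :
    Integrable (fun x => x) (gammaMeasure a r) ∧ ∫ x, x ∂gammaMeasure a r = a / r := by
  have hl : ∫⁻ x, ENNReal.ofReal x ∂gammaMeasure a r = ENNReal.ofReal (a / r) := by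
    rw [lintegral_gammaMeasure (by fun_prop)]
    have h2 : ∫⁻ x, (1 : ENNReal) ∂gammaMeasure (a + 1) r = 1 := by
      have := isProbabilityMeasure_gammaMeasure (a := a + 1) (by linarith) hr
      simp
    rw [lintegral_gammaMeasure (by fun_prop)] at h2
    rw [← mul_one (ENNReal.ofReal (a / r)), ← h2, ← lintegral_const_mul _ (by fun_prop)]
    refine setLIntegral_congr_fun measurableSet_Ioi fun x hx => ?_
    have hx : 0 < x := hx
    have hG := Real.Gamma_pos_of_pos ha
    simp only [mul_one]
    rw [← ENNReal.ofReal_mul (by positivity), ← ENNReal.ofReal_mul (by positivity)]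
    congr 1
    rw [Real.Gamma_add_one ha.ne', Real.rpow_add_one hr.ne', add_sub_cancel_right]
    have : x ^ a = x ^ (a - 1) * x := by
      rw [← Real.rpow_add_one hx.ne', sub_add_cancel]
    rw [this]
    field_simp
  have hi : Integrable (fun x => x) (gammaMeasure a r) := by
    refine ⟨by fun_prop, ?_⟩
    rw [hasFiniteIntegral_iff_ofReal (ae_pos_gammaMeasure.mono fun x hx => hx.le), hl]
    exact ENNReal.ofReal_lt_top
  refine ⟨hi, ?_⟩
  rw [integral_eq_lintegral_of_nonneg_ae (ae_pos_gammaMeasure.mono fun x hx => hx.le)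
    (by fun_prop), hl, ENNReal.toReal_ofReal (by positivity)]

/-- Dominated by `x + 1`. Square roots arise in the cross terms of the outer square of `√ω u₀ + A
z`. -/
theorem integrable_sqrt_gammaMeasure (ha : 0 < a) (hr : 0 < r) :
    Integrable (fun x => √x) (gammaMeasure a r) := by
  have := isProbabilityMeasure_gammaMeasure ha hr
  refine ((integrable_id_gammaMeasure_and_integral ha hr).1.add (integrable_const 1)).mono'
    (by fun_prop) ?_
  filter_upwards [ae_pos_gammaMeasure] with x hx
  simp only [Real.norm_eq_abs, abs_of_nonneg (Real.sqrt_nonneg x), Pi.add_apply]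
  nlinarith [Real.sq_sqrt hx.le, sq_nonneg (√x - 1), Real.sqrt_nonneg x]

end gamma

/-! ### Gaussian integrals, linear and quadratic moments, whitening. -/

/-- Completing a Gaussian integral: translation and a linear substitution `b = β + ω^(-1/2) A z`
turn a Gaussian weight with precision `ω • P`, where `P = (A Aᵀ)⁻¹`, into a standard one. -/
theorem lintegral_gaussian_weight {ι : Type*} [Fintype ι] [DecidableEq ι] {P A : Matrix ι ι ℝ}
    (hA : A.det ≠ 0) (hPA : A.transpose * P * A = 1) (β : ι → ℝ) {ω : ℝ} (hω : 0 < ω)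
    {H : (ι → ℝ) → ENNReal} (hH : Measurable H) :
    ∫⁻ b, ENNReal.ofReal (Real.exp (-(1 / 2) * (ω * ((b - β) ⬝ᵥ P.mulVec (b - β))))) * H b =
      ENNReal.ofReal ((√(2 * Real.pi)) ^ Fintype.card ι * |A.det| * ((√ω)⁻¹) ^ Fintype.card ι) *
        ∫⁻ z, H (β + (√ω)⁻¹ • A.mulVec z) ∂(Measure.pi fun _ : ι => gaussianReal 0 1) := by
  have hs : 0 < √ω := Real.sqrt_pos.2 hω
  set L : Matrix ι ι ℝ := (√ω)⁻¹ • A with hL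
  have hdet : L.det = ((√ω)⁻¹) ^ Fintype.card ι * A.det := by rw [hL, Matrix.det_smul]
  have hL0 : L.det ≠ 0 := by rw [hdet]; positivity
  set E : (ι → ℝ) → ENNReal := fun b =>
    ENNReal.ofReal (Real.exp (-(1 / 2) * (ω * (b ⬝ᵥ P.mulVec b)))) * H (β + b) with hE
  have hEm : Measurable E := by
    refine Measurable.mul ?_ (hH.comp (by fun_prop))
    refine Measurable.ennreal_ofReal (Measurable.exp (Measurable.const_mul
      (Measurable.const_mul ?_ _) _))
    simp only [dotProduct, Matrix.mulVec]
    fun_prop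
  have h1 : ∫⁻ b, ENNReal.ofReal (Real.exp (-(1 / 2) * (ω * ((b - β) ⬝ᵥ P.mulVec (b - β))))) * H b
      = ∫⁻ b, E b := by
    rw [← lintegral_sub_right_eq_self E β]
    refine lintegral_congr fun b => ?_
    simp [hE]
  have hLm : Measurable (Matrix.toLin' L) :=
    (LinearMap.continuous_on_pi (Matrix.toLin' L)).measurable
  have h2 : ∫⁻ b, E b = ENNReal.ofReal |L.det| * ∫⁻ z, E (Matrix.toLin' L z) := by
    rw [← lintegral_map hEm hLm, Real.map_matrix_volume_pi_eq_smul_volume_pi hL0,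
      lintegral_smul_measure, smul_eq_mul, ← mul_assoc, ← ENNReal.ofReal_mul (abs_nonneg _),
      ← abs_mul, mul_inv_cancel₀ hL0, abs_one, ENNReal.ofReal_one, one_mul]
  have hHm : Measurable fun z => H (β + (√ω)⁻¹ • A.mulVec z) := by
    refine hH.comp ?_
    exact measurable_const.add
      ((LinearMap.continuous_on_pi (Matrix.toLin' A)).measurable.const_smul (√ω)⁻¹)
  rw [h1, h2, pi_gaussianReal_eq_withDensity, lintegral_withDensity_eq_lintegral_mul _
    (by simp only [dotProduct]; fun_prop) hHm, ← lintegral_const_mul _ (by exact hEm.comp hLm),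
    ← lintegral_const_mul]
  swap
  · exact Measurable.mul (by simp only [dotProduct]; fun_prop) hHm
  refine lintegral_congr fun z => ?_
  simp only [hE, Pi.mul_apply, Matrix.toLin'_apply]
  have e1 : L.mulVec z = (√ω)⁻¹ • A.mulVec z := by rw [hL, Matrix.smul_mulVec]
  have e2 : ω * (L.mulVec z ⬝ᵥ P.mulVec (L.mulVec z)) = z ⬝ᵥ z := by
    rw [e1, Matrix.mulVec_smul, dotProduct_smul, smul_dotProduct, smul_eq_mul, smul_eq_mul]
    have : A.mulVec z ⬝ᵥ P.mulVec (A.mulVec z) = z ⬝ᵥ z := by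
      rw [Matrix.mulVec_mulVec, Matrix.dotProduct_mulVec, ← Matrix.vecMul_transpose,
        Matrix.vecMul_vecMul, ← Matrix.mul_assoc, hPA, Matrix.vecMul_one]
    rw [this]
    field_simp
    rw [Real.sq_sqrt hω.le, mul_comm]
  rw [e2, e1, ← mul_assoc, ← mul_assoc]
  congr 1
  rw [← ENNReal.ofReal_mul (abs_nonneg _), ← ENNReal.ofReal_mul (by positivity)]
  congr 1
  rw [hdet, abs_mul, abs_of_nonneg (by positivity)]
  have : √(2 * Real.pi) ≠ 0 := by positivity
  have h3 : √(2 * Real.pi) ^ Fintype.card ι * (√(2 * Real.pi))⁻¹ ^ Fintype.card ι = 1 := by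
    rw [← mul_pow, mul_inv_cancel₀ this, one_pow]
  calc _ = (√(2 * Real.pi) ^ Fintype.card ι * (√(2 * Real.pi))⁻¹ ^ Fintype.card ι) *
      ((√ω)⁻¹ ^ Fintype.card ι * |A.det| * Real.exp (-(1 / 2) * (z ⬝ᵥ z))) := by rw [h3, one_mul]
    _ = _ := by ring

section gaussianLinear

variable {ι : Type*} [Fintype ι]

theorem integrable_dotProduct_pi_gaussian (c : ι → ℝ) :
    Integrable (fun z : ι → ℝ => c ⬝ᵥ z) (Measure.pi fun _ : ι => gaussianReal 0 1) := by
  simp only [dotProduct]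
  exact integrable_finsetSum _ fun i _ => (integrable_eval_pi_gaussian i).const_mul _

theorem integral_dotProduct_pi_gaussian (c : ι → ℝ) :
    ∫ z : ι → ℝ, c ⬝ᵥ z ∂(Measure.pi fun _ : ι => gaussianReal 0 1) = 0 := by
  simp only [dotProduct]
  rw [integral_finsetSum _ fun i _ => (integrable_eval_pi_gaussian i).const_mul _]
  simp [integral_const_mul, integral_eval_pi_gaussian]

theorem dotProduct_mul_dotProduct (c d z : ι → ℝ) :
    (c ⬝ᵥ z) * (d ⬝ᵥ z) = ∑ i, ∑ j, c i * d j * (z i * z j) := by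
  simp only [dotProduct, Finset.sum_mul_sum]
  exact Finset.sum_congr rfl fun i _ => Finset.sum_congr rfl fun j _ => by ring

theorem integrable_dotProduct_mul_pi_gaussian (c d : ι → ℝ) :
    Integrable (fun z : ι → ℝ => (c ⬝ᵥ z) * (d ⬝ᵥ z))
      (Measure.pi fun _ : ι => gaussianReal 0 1) := by
  simp only [dotProduct_mul_dotProduct]
  exact integrable_finsetSum _ fun i _ => integrable_finsetSum _ fun j _ =>
    (integrable_eval_mul_eval_pi_gaussian i j).const_mul _

theorem integral_dotProduct_mul_pi_gaussian (c d : ι → ℝ) :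
    ∫ z : ι → ℝ, (c ⬝ᵥ z) * (d ⬝ᵥ z) ∂(Measure.pi fun _ : ι => gaussianReal 0 1) = c ⬝ᵥ d := by
  classical
  simp only [dotProduct_mul_dotProduct]
  rw [integral_finsetSum _ fun i _ => integrable_finsetSum _ fun j _ =>
    (integrable_eval_mul_eval_pi_gaussian i j).const_mul _]
  simp only [dotProduct]
  refine Finset.sum_congr rfl fun i _ => ?_
  rw [integral_finsetSum _ fun j _ => (integrable_eval_mul_eval_pi_gaussian i j).const_mul _]
  simp [integral_const_mul, integral_eval_mul_eval_pi_gaussian]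

end gaussianLinear

/-- Factor `P = Bᵀ B` and take `A = B⁻¹`: `A` maps a standard Gaussian vector to one with covariance
`P⁻¹`. -/
theorem Matrix.PosDef.exists_whitening {ι : Type*} [Fintype ι] [DecidableEq ι]
    {P : Matrix ι ι ℝ} (hP : P.PosDef) :
    ∃ A : Matrix ι ι ℝ, A.det ≠ 0 ∧ A.transpose * P * A = 1 ∧ A * A.transpose = P⁻¹ := by
  obtain ⟨B, hB⟩ : ∃ B : Matrix ι ι ℝ, P = B.transpose * B := by
    open scoped MatrixOrder in
    obtain ⟨B, hB⟩ := CStarAlgebra.nonneg_iff_eq_star_mul_self.mp hP.posSemidef.nonneg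
    exact ⟨B, by simpa [Matrix.star_eq_conjTranspose] using hB⟩
  have hdet : IsUnit B.det := by
    have := hP.det_pos.ne'
    rw [hB, Matrix.det_mul, Matrix.det_transpose] at this
    exact isUnit_iff_ne_zero.2 (left_ne_zero_of_mul this)
  have hdt : IsUnit B.transpose.det := by rwa [Matrix.det_transpose]
  refine ⟨B⁻¹, ?_, ?_, ?_⟩
  · exact (Matrix.isUnit_nonsing_inv_det B hdet).ne_zero
  · rw [hB, Matrix.transpose_nonsing_inv, ← Matrix.mul_assoc, Matrix.nonsing_inv_mul _ hdt,
      Matrix.one_mul, Matrix.mul_nonsing_inv _ hdet]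
  · rw [hB, Matrix.mul_inv_rev, Matrix.transpose_nonsing_inv]

/-! ### Regression of a vertex on its neighbours and bordered inverses. -/

section star

variable {V : Type*} [DecidableEq V]

/-- A vector indexed by a finite set of vertices, extended by zeros. -/
def extendVec (N : Finset V) (b : N → ℝ) : V → ℝ :=
  fun i => if h : i ∈ N then b ⟨i, h⟩ else 0

/-- The vector with entry `1` at `v`, entries `b` on `N` and zeros elsewhere. -/
def starVec (v : V) (N : Finset V) (b : N → ℝ) : V → ℝ :=
  Pi.single v 1 + extendVec N b

theorem extendVec_add (N : Finset V) (b c : N → ℝ) :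
    extendVec N (b + c) = extendVec N b + extendVec N c := by
  ext i; simp only [extendVec, Pi.add_apply]; split_ifs <;> simp

theorem extendVec_smul (N : Finset V) (t : ℝ) (b : N → ℝ) :
    extendVec N (t • b) = t • extendVec N b := by
  ext i; simp only [extendVec, Pi.smul_apply]; split_ifs <;> simp

theorem measurable_extendVec (N : Finset V) : Measurable (extendVec N) := by
  refine measurable_pi_lambda _ fun i => ?_
  unfold extendVec
  split_ifs <;> fun_prop

variable [Fintype V]

omit [DecidableEq V] in
theorem sum_eq_sum_coe_of_forall_notMem {B : Finset V} {F : V → ℝ} (h : ∀ i, i ∉ B → F i = 0) :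
    ∑ i, F i = ∑ i : B, F i := by
  rw [Finset.sum_coe_sort B F]
  exact (Finset.sum_subset (Finset.subset_univ B) fun i _ hi => h i hi).symm

theorem extendVec_dotProduct (N : Finset V) (b : N → ℝ) (w : V → ℝ) :
    extendVec N b ⬝ᵥ w = b ⬝ᵥ fun i : N => w i := by
  simp only [dotProduct]
  rw [sum_eq_sum_coe_of_forall_notMem (B := N) fun i hi => by simp [extendVec, hi]]
  exact Finset.sum_congr rfl fun i _ => by simp [extendVec]

theorem mulVec_extendVec_apply (Φ : Matrix V V ℝ) (N : Finset V) (b : N → ℝ) (i : N) :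
    Φ.mulVec (extendVec N b) i = (block Φ N).mulVec b i := by
  rw [Matrix.mulVec, dotProduct_comm, extendVec_dotProduct, dotProduct_comm]
  rfl

variable {Φ : Matrix V V ℝ} {v : V} {N : Finset V}

omit [DecidableEq V] [Fintype V] in
theorem block_posDef (hΦ : Φ.PosDef) (B : Finset V) : (block Φ B).PosDef :=
  hΦ.submatrix Subtype.val_injective

/-- The regression vector of `v` on `N`: the minimizer of `b ↦ uᵀ Φ u`, `u = starVec v N b`. -/
noncomputable def starMean (Φ : Matrix V V ℝ) (v : V) (N : Finset V) : N → ℝ :=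
  -(block Φ N)⁻¹.mulVec fun i => Φ v i

/-- The residual `Φ_vv - Φ_vN Φ_NN⁻¹ Φ_Nv`. -/
noncomputable def starResidual (Φ : Matrix V V ℝ) (v : V) (N : Finset V) : ℝ :=
  Φ v v + (starMean Φ v N) ⬝ᵥ fun i => Φ v i

omit [Fintype V] in
theorem block_mulVec_starMean (hΦ : Φ.PosDef) :
    (block Φ N).mulVec (starMean Φ v N) = -fun i : N => Φ v i := by
  have hu : IsUnit (block Φ N).det := isUnit_iff_ne_zero.2 (block_posDef hΦ N).det_pos.ne'
  rw [starMean, Matrix.mulVec_neg, Matrix.mulVec_mulVec, Matrix.mul_nonsing_inv _ hu,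
    Matrix.one_mulVec]

theorem mulVec_starVec_mean_apply (hΦ : Φ.PosDef) {i : V} (hi : i ∈ N) :
    Φ.mulVec (starVec v N (starMean Φ v N)) i = 0 := by
  have h1 := congrFun (block_mulVec_starMean (v := v) (N := N) hΦ) ⟨i, hi⟩
  have h2 := mulVec_extendVec_apply Φ N (starMean Φ v N) ⟨i, hi⟩
  have h3 : Φ i v = Φ v i := by simpa using hΦ.isHermitian.apply v i
  rw [starVec, Matrix.mulVec_add, Pi.add_apply, Matrix.mulVec_single_one]
  simp only at h2
  rw [h2, h1]
  simp [h3]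

theorem mulVec_starVec_mean_self :
    Φ.mulVec (starVec v N (starMean Φ v N)) v = starResidual Φ v N := by
  rw [starVec, Matrix.mulVec_add, Pi.add_apply, Matrix.mulVec_single_one, starResidual,
    Matrix.mulVec, dotProduct_comm, extendVec_dotProduct]
  rfl

/-- At the regression vector, `Φ u` vanishes on `N`, so `u` is `Φ`-orthogonal to every vector
supported on `N`; the cross terms of the expansion about it drop out. -/
theorem starVec_quadratic (hΦ : Φ.PosDef) (b : N → ℝ) :
    starVec v N b ⬝ᵥ Φ.mulVec (starVec v N b) = starResidual Φ v N +
      (b - starMean Φ v N) ⬝ᵥ (block Φ N).mulVec (b - starMean Φ v N) := by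
  set β := starMean Φ v N with hβ
  have hs : ∀ x y : V → ℝ, x ⬝ᵥ Φ.mulVec y = y ⬝ᵥ Φ.mulVec x := by
    intro x y
    have ht : Φ.transpose = Φ := by
      simpa [Matrix.IsSymm] using hΦ.isHermitian
    rw [Matrix.dotProduct_mulVec, ← Matrix.mulVec_transpose, ht, dotProduct_comm]
  have hz : ∀ c : N → ℝ, extendVec N c ⬝ᵥ Φ.mulVec (starVec v N β) = 0 := by
    intro c
    rw [extendVec_dotProduct]
    have : (fun i : N => Φ.mulVec (starVec v N β) i) = 0 := by
      ext i; exact mulVec_starVec_mean_apply hΦ i.2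
    rw [this, dotProduct_zero]
  have e : starVec v N b = starVec v N β + extendVec N (b - β) := by
    rw [starVec, starVec, add_assoc, ← extendVec_add, add_sub_cancel]
  have h0 : starVec v N β ⬝ᵥ Φ.mulVec (starVec v N β) = starResidual Φ v N := by
    conv_lhs => rw [starVec, add_dotProduct, ← starVec, hz, add_zero, single_one_dotProduct]
    exact mulVec_starVec_mean_self
  have h1 : extendVec N (b - β) ⬝ᵥ Φ.mulVec (extendVec N (b - β)) =
      (b - β) ⬝ᵥ (block Φ N).mulVec (b - β) := by
    rw [extendVec_dotProduct]
    congr 1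
    ext i
    exact mulVec_extendVec_apply Φ N _ i
  rw [e, Matrix.mulVec_add, add_dotProduct, dotProduct_add, dotProduct_add, h0, hz,
    hs (starVec v N β), hz, h1]
  ring

theorem starResidual_pos (hΦ : Φ.PosDef) (hv : v ∉ N) : 0 < starResidual Φ v N := by
  have h := starVec_quadratic (v := v) hΦ (starMean Φ v N)
  rw [sub_self, zero_dotProduct, add_zero] at h
  rw [← h]
  have hne : starVec v N (starMean Φ v N) ≠ 0 := by
    intro h0
    have := congrFun h0 v
    simp [starVec, extendVec, hv] at this
  simpa using hΦ.dotProduct_mulVec_pos hne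

omit [Fintype V] in
theorem pad_smul {B : Finset V} (t : ℝ) (A : Matrix B B ℝ) : pad (t • A) = t • pad A := by
  ext i j; simp only [pad, Matrix.of_apply, Matrix.smul_apply]; split_ifs <;> simp

/-- The inverse of a bordered block. -/
theorem pad_inv_block_insert (hΦ : Φ.PosDef) (hv : v ∉ N) :
    pad (block Φ (insert v N))⁻¹ = pad (block Φ N)⁻¹ + (starResidual Φ v N)⁻¹ •
      Matrix.vecMulVec (starVec v N (starMean Φ v N)) (starVec v N (starMean Φ v N)) := by
  set φ := starResidual Φ v N
  set u := starVec v N (starMean Φ v N) with hu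
  have hφ : φ ≠ 0 := (starResidual_pos hΦ hv).ne'
  set X : Matrix V V ℝ := pad (block Φ N)⁻¹ + φ⁻¹ • Matrix.vecMulVec u u with hX
  have hu0 : ∀ i, i ∉ insert v N → u i = 0 := by
    intro i hi
    rw [Finset.mem_insert, not_or] at hi
    simp [hu, starVec, extendVec, hi.1, hi.2]
  have hX0 : ∀ i j, ¬ (i ∈ insert v N ∧ j ∈ insert v N) → X i j = 0 := by
    intro i j hij
    have h1 : ¬ (i ∈ N ∧ j ∈ N) := fun h =>
      hij ⟨Finset.mem_insert_of_mem h.1, Finset.mem_insert_of_mem h.2⟩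
    have h2 : u i * u j = 0 := by
      rcases not_and_or.1 hij with h | h <;> simp [hu0 _ h]
    simp [hX, pad, h1, Matrix.vecMulVec_apply, h2]
  have hPinv : (block Φ N)⁻¹ * block Φ N = 1 :=
    Matrix.nonsing_inv_mul _ (isUnit_iff_ne_zero.2 (block_posDef hΦ N).det_pos.ne')
  -- A left inverse suffices. The product is computed column by column: `Φ u` equals `φ` at `v` and
  -- zero on `N`, so the rank-one part affects only column `v`.
  have hmul : block X (insert v N) * block Φ (insert v N) = 1 := by
    ext i j
    have e1 : (block X (insert v N) * block Φ (insert v N)) i j = (X * Φ) i j := by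
      rw [Matrix.mul_apply, Matrix.mul_apply]
      exact (sum_eq_sum_coe_of_forall_notMem (F := fun k => X i k * Φ k j) fun k hk => by
        rw [hX0 _ _ fun h => hk h.2, zero_mul]).symm
    have e2 : (Matrix.vecMulVec u u * Φ) i j = u i * Φ.mulVec u j := by
      rw [Matrix.vecMulVec_mul, Matrix.vecMulVec_apply, ← Matrix.mulVec_transpose]
      have ht : Φ.transpose = Φ := by simpa [Matrix.IsSymm] using hΦ.isHermitian
      rw [ht]
    have e3 : (pad (block Φ N)⁻¹ * Φ) i j =
        if h : i.1 ∈ N then ∑ k : N, (block Φ N)⁻¹ ⟨i.1, h⟩ k * Φ k j else 0 := by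
      rw [Matrix.mul_apply]
      split_ifs with h
      · rw [sum_eq_sum_coe_of_forall_notMem (B := N) fun k hk => by simp [pad, hk]]
        exact Finset.sum_congr rfl fun k _ => by simp [pad, h]
      · exact Finset.sum_eq_zero fun k _ => by simp [pad, h]
    rw [e1, hX, Matrix.add_mul, Matrix.smul_mul, Matrix.add_apply, Matrix.smul_apply, e2, e3,
      smul_eq_mul, Matrix.one_apply]
    obtain ⟨i, hi⟩ := i
    obtain ⟨j, hj⟩ := j
    simp only [Subtype.mk.injEq]
    rcases Finset.mem_insert.1 hj with rfl | hjN
    · rw [hu, mulVec_starVec_mean_self, ← hu]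
      rcases Finset.mem_insert.1 hi with rfl | hiN
      · simp [hv, hu, starVec, extendVec, φ, hφ]
      · have hij : i ≠ j := fun h => hv (h ▸ hiN)
        have h1 : ∑ k : N, (block Φ N)⁻¹ ⟨i, hiN⟩ k * Φ k j = -u i := by
          have h3 : ∀ k, Φ k j = Φ j k := fun k => by simpa using hΦ.isHermitian.apply j k
          simp [hu, starVec, extendVec, hiN, hij, starMean, Matrix.mulVec, dotProduct, h3]
        rw [dif_pos hiN, h1, if_neg hij]
        field_simp
        ring
    · rw [hu, mulVec_starVec_mean_apply hΦ hjN, ← hu, mul_zero, mul_zero, add_zero]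
      rcases Finset.mem_insert.1 hi with rfl | hiN
      · have hij : i ≠ j := fun h => hv (h ▸ hjN)
        simp [hv, hij]
      · have h1 := congrFun (congrFun hPinv ⟨i, hiN⟩) ⟨j, hjN⟩
        rw [Matrix.mul_apply, Matrix.one_apply] at h1
        simp only [block, Matrix.submatrix_apply, Subtype.mk.injEq] at h1
        rw [dif_pos hiN]
        exact h1
  have hinv : (block Φ (insert v N))⁻¹ = block X (insert v N) := Matrix.inv_eq_left_inv hmul
  rw [hinv]
  ext i j
  by_cases h : i ∈ insert v N ∧ j ∈ insert v N
  · simp only [pad, Matrix.of_apply, dif_pos h]; rfl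
  · rw [hX0 i j h]; simp only [pad, Matrix.of_apply, dif_neg h]

/-- The contribution of a complete set of vertices `B` to the posterior mean. -/
noncomputable def cliqueTerm (δ : ℝ) (Φ : Matrix V V ℝ) (B : Finset V) : Matrix V V ℝ :=
  pad ((δ + (B.card : ℝ) - 1) • (block Φ B)⁻¹)

/-- The coefficients of the two terms are `δ + |N|` and `δ + |N| - 1`. Once the bordered inverse is
expanded, `Φ_NN⁻¹` survives exactly once, and the rank-one part keeps the full factor `δ + |N|`. -/
theorem cliqueTerm_insert_sub (hΦ : Φ.PosDef) (hv : v ∉ N) (δ : ℝ) :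
    cliqueTerm δ Φ (insert v N) - cliqueTerm δ Φ N =
      ((δ + N.card) / starResidual Φ v N) •
        Matrix.vecMulVec (starVec v N (starMean Φ v N)) (starVec v N (starMean Φ v N)) +
      pad (block Φ N)⁻¹ := by
  rw [cliqueTerm, cliqueTerm, pad_smul, pad_smul, pad_inv_block_insert hΦ hv,
    Finset.card_insert_of_notMem hv]
  ext i j
  simp only [Matrix.add_apply, Matrix.sub_apply, Matrix.smul_apply, smul_eq_mul]
  push_cast
  ring

/-! ### The random contribution of one vertex. -/

/-- The random vector `√ω u₀ + A z` of the star of `v`, whose outer square is the part of the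
matrix contributed by `v`. -/
noncomputable def starSample (u₀ : V → ℝ) (N : Finset V) (A : Matrix N N ℝ) (p : ℝ × (N → ℝ)) :
    V → ℝ :=
  √p.1 • u₀ + extendVec N (A.mulVec p.2)

theorem measurable_starSample (u₀ : V → ℝ) (N : Finset V) (A : Matrix N N ℝ) :
    Measurable (starSample u₀ N A) := by
  have h1 : Measurable fun p : ℝ × (N → ℝ) => √p.1 • u₀ :=
    measurable_pi_lambda _ fun i => by
      simp only [Pi.smul_apply, smul_eq_mul]; fun_prop
  have h2 : Measurable fun p : ℝ × (N → ℝ) => extendVec N (A.mulVec p.2) :=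
    (measurable_extendVec N).comp
      ((LinearMap.continuous_on_pi (Matrix.toLin' A)).measurable.comp measurable_snd)
  exact h1.add h2

omit [Fintype V] [DecidableEq V] in
theorem measurable_vecMulVec_self : Measurable fun s : V → ℝ => Matrix.vecMulVec s s :=
  measurable_pi_lambda _ fun i => measurable_pi_lambda _ fun j =>
    (measurable_pi_apply i).mul (measurable_pi_apply j)

omit [Fintype V] [DecidableEq V] in
theorem measurable_matrix_apply (i j : V) : Measurable fun M : Matrix V V ℝ => M i j :=
  (measurable_pi_apply j).comp (measurable_pi_apply i)

omit [Fintype V] in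
-- The Gamma and Gaussian variables are independent and the Gaussian is centred, so the cross terms
-- integrate to zero; what remains is the Gamma mean times `u₀ u₀ᵀ` and the covariance `A Aᵀ`.
theorem integrable_starSample_mul {a r : ℝ} (ha : 0 < a) (hr : 0 < r) (u₀ : V → ℝ) (N : Finset V)
    (A : Matrix N N ℝ) (i j : V) :
    Integrable (fun p => starSample u₀ N A p i * starSample u₀ N A p j)
      ((gammaMeasure a r).prod (Measure.pi fun _ : N => gaussianReal 0 1)) ∧
    ∫ p, starSample u₀ N A p i * starSample u₀ N A p j
      ∂((gammaMeasure a r).prod (Measure.pi fun _ : N => gaussianReal 0 1)) =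
      (a / r) * (u₀ i * u₀ j) + pad (A * A.transpose) i j := by
  have hprob := isProbabilityMeasure_gammaMeasure ha hr
  set c : V → N → ℝ := fun i k => if h : i ∈ N then A ⟨i, h⟩ k else 0 with hc
  have hw : ∀ (z : N → ℝ) i, extendVec N (A.mulVec z) i = c i ⬝ᵥ z := by
    intro z i
    by_cases h : i ∈ N <;> simp [extendVec, hc, h, Matrix.mulVec, dotProduct]
  have hcc : c i ⬝ᵥ c j = pad (A * A.transpose) i j := by
    by_cases hi : i ∈ N <;> by_cases hj : j ∈ N <;>
      simp [pad, hc, hi, hj, Matrix.mul_apply, dotProduct]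
  set γ := gammaMeasure a r
  set G := Measure.pi fun _ : N => gaussianReal 0 1
  obtain ⟨hid, hida⟩ := integrable_id_gammaMeasure_and_integral ha hr
  have hsq := integrable_sqrt_gammaMeasure ha hr
  -- The identity holds only almost everywhere: `√ω * √ω = ω` needs `ω ≥ 0`.
  have e : (fun p => starSample u₀ N A p i * starSample u₀ N A p j) =ᵐ[γ.prod G] fun p =>
      (p.1 * (u₀ i * u₀ j) + (√p.1 * (u₀ i * (c j ⬝ᵥ p.2)) + √p.1 * (u₀ j * (c i ⬝ᵥ p.2)))) +
        (c i ⬝ᵥ p.2) * (c j ⬝ᵥ p.2) := by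
    have hpos : ∀ᵐ p ∂γ.prod G, 0 < p.1 :=
      Measure.quasiMeasurePreserving_fst.ae ae_pos_gammaMeasure
    filter_upwards [hpos] with p hp
    simp only [starSample, Pi.add_apply, Pi.smul_apply, smul_eq_mul, hw]
    have := Real.mul_self_sqrt hp.le
    linear_combination (u₀ i * u₀ j) * this
  have i1 : Integrable (fun p : ℝ × (N → ℝ) => p.1 * (u₀ i * u₀ j)) (γ.prod G) :=
    hid.mul_prod (integrable_const (u₀ i * u₀ j))
  have i2 : ∀ k l : V, Integrable (fun p : ℝ × (N → ℝ) => √p.1 * (u₀ k * (c l ⬝ᵥ p.2)))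
      (γ.prod G) := fun k l =>
    hsq.mul_prod ((integrable_dotProduct_pi_gaussian (c l)).const_mul (u₀ k))
  have i3 : Integrable (fun p : ℝ × (N → ℝ) => (c i ⬝ᵥ p.2) * (c j ⬝ᵥ p.2)) (γ.prod G) :=
    (integrable_dotProduct_mul_pi_gaussian (c i) (c j)).comp_snd γ
  refine ⟨(((i1.add ((i2 i j).add (i2 j i))).add i3).congr e.symm), ?_⟩
  have z2 : ∀ k l : V, ∫ p, √p.1 * (u₀ k * (c l ⬝ᵥ p.2)) ∂γ.prod G = 0 := by
    intro k l
    rw [integral_prod_mul (fun x => √x) (fun z => u₀ k * (c l ⬝ᵥ z)), integral_const_mul,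
      integral_dotProduct_pi_gaussian, mul_zero, mul_zero]
  have z1 : ∫ p, p.1 * (u₀ i * u₀ j) ∂γ.prod G = (a / r) * (u₀ i * u₀ j) := by
    rw [integral_mul_const, integral_fun_fst (fun x : ℝ => x), hida]
    simp
  have z3 : ∫ p, (c i ⬝ᵥ p.2) * (c j ⬝ᵥ p.2) ∂γ.prod G = pad (A * A.transpose) i j := by
    rw [integral_fun_snd (fun z => (c i ⬝ᵥ z) * (c j ⬝ᵥ z)),
      integral_dotProduct_mul_pi_gaussian, hcc]
    simp
  have i4 : Integrable (fun p : ℝ × (N → ℝ) => √p.1 * (u₀ i * (c j ⬝ᵥ p.2)) +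
      √p.1 * (u₀ j * (c i ⬝ᵥ p.2))) (γ.prod G) := (i2 i j).add (i2 j i)
  have i5 : Integrable (fun p : ℝ × (N → ℝ) => p.1 * (u₀ i * u₀ j) +
      (√p.1 * (u₀ i * (c j ⬝ᵥ p.2)) + √p.1 * (u₀ j * (c i ⬝ᵥ p.2)))) (γ.prod G) := i1.add i4
  rw [integral_congr_ae e, integral_add i5 i3, integral_add i1 i4,
    integral_add (i2 i j) (i2 j i), z1, z2, z2, z3]
  ring

/-- The law of the part `ω u uᵀ` of the matrix contributed by a simplicial vertex `v` with
neighbours `N`, and its mean. -/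
theorem exists_starLaw (hΦ : Φ.PosDef) (hv : v ∉ N) {δ : ℝ} (hδ : 0 < δ) :
    ∃ (c : ENNReal) (ρ : Measure (Matrix V V ℝ)), c ≠ 0 ∧ c ≠ ⊤ ∧ IsProbabilityMeasure ρ ∧
      (∀ F : Matrix V V ℝ → ENNReal, Measurable F →
        ∫⁻ ω in Set.Ioi (0 : ℝ), ∫⁻ b : N → ℝ, ENNReal.ofReal (ω ^ ((δ - 2) / 2 + N.card) *
          Real.exp (-(1 / 2) * (ω * (starVec v N b ⬝ᵥ Φ.mulVec (starVec v N b))))) *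
            F (ω • Matrix.vecMulVec (starVec v N b) (starVec v N b)) = c * ∫⁻ M, F M ∂ρ) ∧
      (∀ i j, Integrable (fun M => M i j) ρ) ∧
      ∀ i j, ∫ M, M i j ∂ρ = (cliqueTerm δ Φ (insert v N) - cliqueTerm δ Φ N) i j := by
  obtain ⟨A, hA, hPA, hAA⟩ := (block_posDef hΦ N).exists_whitening
  have hφ := starResidual_pos hΦ hv
  set φ := starResidual Φ v N with hφdef
  set β := starMean Φ v N with hβ
  -- Integrating out `b` contributes `ω ^ (-|N| / 2)`, so the exponent of `ω` becomes `(δ - 2) / 2 +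
  -- |N| / 2 = a - 1`. The rate is half the constant left after completing the square.
  set a : ℝ := (δ + N.card) / 2 with ha
  set r : ℝ := φ / 2 with hr
  have ha0 : 0 < a := by positivity
  have hr0 : 0 < r := by positivity
  have hprob := isProbabilityMeasure_gammaMeasure ha0 hr0
  set u₀ := starVec v N β with hu₀
  have hT : Measurable fun p => Matrix.vecMulVec (starSample u₀ N A p) (starSample u₀ N A p) :=
    measurable_vecMulVec_self.comp (measurable_starSample u₀ N A)
  have hG := Real.Gamma_pos_of_pos ha0
  -- The normalizing constant of the Gaussian in `b`, with its power of `ω` removed, times that of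
  -- the Gamma law.
  set c₀ : ℝ := (√(2 * Real.pi)) ^ N.card * |A.det| * (Real.Gamma a / r ^ a) with hc₀
  have hc₀pos : 0 < c₀ := by
    have : 0 < |A.det| := abs_pos.2 hA
    positivity
  refine ⟨ENNReal.ofReal c₀, Measure.map (fun p =>
    Matrix.vecMulVec (starSample u₀ N A p) (starSample u₀ N A p))
    ((gammaMeasure a r).prod (Measure.pi fun _ : N => gaussianReal 0 1)),
    (ENNReal.ofReal_pos.2 hc₀pos).ne', ENNReal.ofReal_ne_top,
    Measure.isProbabilityMeasure_map hT.aemeasurable, ?_, ?_, ?_⟩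
  · intro F hF
    have hFT : Measurable fun p => F (Matrix.vecMulVec (starSample u₀ N A p)
        (starSample u₀ N A p)) := hF.comp hT
    rw [lintegral_map hF hT, lintegral_prod _ hFT.aemeasurable,
      lintegral_gammaMeasure (Measurable.lintegral_prod_right' hFT),
      ← lintegral_const_mul']
    swap
    · exact ENNReal.ofReal_ne_top
    refine setLIntegral_congr_fun measurableSet_Ioi fun ω hω => ?_
    have hω : 0 < ω := hω
    have hs : 0 < √ω := Real.sqrt_pos.2 hω
    have hmeas : Measurable fun b : N → ℝ =>
        F (ω • Matrix.vecMulVec (starVec v N b) (starVec v N b)) := by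
      refine hF.comp ?_
      have : Measurable fun b : N → ℝ => starVec v N b :=
        measurable_const.add (measurable_extendVec N)
      exact measurable_pi_lambda _ fun i => measurable_pi_lambda _ fun j =>
        ((((measurable_pi_apply i).comp this).mul
          ((measurable_pi_apply j).comp this)).const_mul ω)
    have key := lintegral_gaussian_weight hA hPA β hω hmeas
    have e1 : ∀ b : N → ℝ, ENNReal.ofReal (ω ^ ((δ - 2) / 2 + N.card) *
          Real.exp (-(1 / 2) * (ω * (starVec v N b ⬝ᵥ Φ.mulVec (starVec v N b))))) *
            F (ω • Matrix.vecMulVec (starVec v N b) (starVec v N b)) =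
        ENNReal.ofReal (ω ^ ((δ - 2) / 2 + N.card) * Real.exp (-(r * ω))) *
        (ENNReal.ofReal (Real.exp (-(1 / 2) * (ω * ((b - β) ⬝ᵥ (block Φ N).mulVec (b - β))))) *
          F (ω • Matrix.vecMulVec (starVec v N b) (starVec v N b))) := by
      intro b
      rw [← mul_assoc (ENNReal.ofReal _) (ENNReal.ofReal _) _,
        ← ENNReal.ofReal_mul (by positivity), starVec_quadratic hΦ]
      congr 2
      rw [mul_assoc, ← Real.exp_add]
      congr 2
      rw [hr]; ring
    simp_rw [e1]
    rw [lintegral_const_mul' _ _ ENNReal.ofReal_ne_top, key, Fintype.card_coe, ← mul_assoc,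
      ← mul_assoc, ← ENNReal.ofReal_mul (by positivity), ← ENNReal.ofReal_mul hc₀pos.le]
    congr 1
    · congr 1
      have e2 : ω ^ ((δ - 2) / 2 + N.card) * (√ω)⁻¹ ^ N.card = ω ^ (a - 1) := by
        rw [inv_pow, ← Real.rpow_natCast (√ω), Real.sqrt_eq_rpow, ← Real.rpow_mul hω.le,
          ← Real.rpow_neg hω.le, ← Real.rpow_add hω]
        congr 1
        rw [ha]; ring
      rw [← e2, hc₀]
      have : r ^ a ≠ 0 := by positivity
      field_simp
    · refine lintegral_congr fun z => ?_
      have e3 : starSample u₀ N A (ω, z) = √ω • starVec v N (β + (√ω)⁻¹ • A.mulVec z) := by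
        have e4 : starVec v N (β + (√ω)⁻¹ • A.mulVec z) =
            u₀ + (√ω)⁻¹ • extendVec N (A.mulVec z) := by
          rw [hu₀, starVec, starVec, extendVec_add, extendVec_smul, ← add_assoc]
        rw [starSample, e4, smul_add, smul_smul, mul_inv_cancel₀ hs.ne', one_smul]
      simp only [e3, Matrix.smul_vecMulVec, Matrix.vecMulVec_smul, smul_smul,
        Real.mul_self_sqrt hω.le]
  · intro i j
    rw [integrable_map_measure (measurable_matrix_apply i j).aestronglyMeasurable hT.aemeasurable]
    exact (integrable_starSample_mul ha0 hr0 u₀ N A i j).1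
  · intro i j
    rw [integral_map hT.aemeasurable (measurable_matrix_apply i j).aestronglyMeasurable]
    simp only [Matrix.vecMulVec_apply]
    rw [(integrable_starSample_mul ha0 hr0 u₀ N A i j).2, cliqueTerm_insert_sub hΦ hv, hAA,
      Matrix.add_apply, Matrix.smul_apply, Matrix.vecMulVec_apply, smul_eq_mul]
    congr 2
    have : a / r = (δ + N.card) / φ := by rw [ha, hr]; field_simp
    exact this

end star

/-! ### Determinant and positivity when a vertex is added. -/

section completion

variable {V : Type*} [Fintype V] [DecidableEq V]

/-- A matrix supported on `W × W`, completed by ones on the diagonal outside `W`. -/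
def completion (W : Finset V) (M : Matrix V V ℝ) : Matrix V V ℝ :=
  M + Matrix.diagonal fun i => if i ∈ W then 0 else 1

variable {v : V} {N W : Finset V} {M : Matrix V V ℝ}

/-- With `e` the unit vector at `v` and `w` the extension of `b`, take the unipotent `U = 1 + w eᵀ`.
It sends `e` to `u` and fixes matrices whose row and column `v` vanish, so it carries `ω e eᵀ` to `ω
u uᵀ` and leaves the `M` part alone. Completing by ones keeps all matrices indexed by `V`. -/
theorem star_completion_factor (hv : v ∉ W) (hN : N ⊆ W)
    (hM : ∀ i j, ¬ (i ∈ W ∧ j ∈ W) → M i j = 0) (ω : ℝ) (b : N → ℝ) :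
    ∃ U : Matrix V V ℝ, U.det = 1 ∧
      completion (insert v W) (ω • Matrix.vecMulVec (starVec v N b) (starVec v N b) + M) =
        U * (completion W M * Matrix.diagonal (Function.update 1 v ω)) * U.transpose := by
  set e : V → ℝ := Pi.single v 1 with he
  set w : V → ℝ := extendVec N b with hw
  have hwv : w v = 0 := by
    rw [hw, extendVec, dif_neg fun h => hv (hN h)]
  set D : Matrix V V ℝ := completion (insert v W) M with hD
  have hDl : ∀ j, D v j = 0 := by
    intro j
    by_cases hj : v = j
    · subst hj; simp [hD, completion, hM v v (fun h => hv h.1)]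
    · simp [hD, completion, hM v j (fun h => hv h.1), hj]
  have hDr : ∀ i, D i v = 0 := by
    intro i
    by_cases hi : i = v
    · subst hi; exact hDl _
    · simp [hD, completion, hM i v (fun h => hv h.2), hi]
  set U : Matrix V V ℝ := 1 + Matrix.vecMulVec w e with hU
  have hX : completion W M * Matrix.diagonal (Function.update 1 v ω) =
      D + ω • Matrix.vecMulVec e e := by
    ext i j
    rw [Matrix.mul_diagonal]
    by_cases hj : j = v
    · subst hj
      by_cases hi : i = j
      · subst hi
        simp [hDl, completion, hM i i (fun h => hv h.1), hv, he, Matrix.vecMulVec_apply]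
      · simp [hDr, completion, hM i j (fun h => hv h.2), hi, he, Matrix.vecMulVec_apply]
    · rw [Function.update_of_ne hj]
      simp only [completion, hD, Matrix.add_apply, Matrix.diagonal_apply, Pi.one_apply, mul_one,
        Matrix.smul_apply, Matrix.vecMulVec_apply, he, Pi.single_eq_of_ne hj, mul_zero, smul_zero,
        add_zero]
      by_cases hi : i = j
      · subst hi; simp [hj]
      · simp [hi]
  have hUD : U * D = D := by
    rw [hU, Matrix.add_mul, Matrix.one_mul, Matrix.vecMulVec_mul]
    have : Matrix.vecMul e D = 0 := by
      ext j; rw [he, Matrix.single_one_vecMul]; exact hDl j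
    rw [this]; simp
  have hDU : D * U.transpose = D := by
    rw [hU, Matrix.transpose_add, Matrix.transpose_one, Matrix.mul_add, Matrix.mul_one,
      Matrix.transpose_vecMulVec, Matrix.mul_vecMulVec]
    have : D.mulVec e = 0 := by
      ext j; rw [he, Matrix.mulVec_single_one]; exact hDr j
    rw [this]; simp
  have hUe : U.mulVec e = starVec v N b := by
    rw [hU, Matrix.add_mulVec, Matrix.one_mulVec, Matrix.vecMulVec_mulVec]
    simp [he, hw, starVec]
  refine ⟨U, ?_, ?_⟩
  · rw [hU, Matrix.vecMulVec_eq Unit, Matrix.det_one_add_replicateCol_mul_replicateRow]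
    simp [he, hwv]
  · rw [hX, Matrix.mul_add, hUD, Matrix.add_mul, hDU, Matrix.mul_smul, Matrix.mul_vecMulVec,
      Matrix.smul_mul, Matrix.vecMulVec_mul, Matrix.vecMul_transpose, hUe, hD, completion,
      completion]
    abel

theorem det_completion_star (hv : v ∉ W) (hN : N ⊆ W)
    (hM : ∀ i j, ¬ (i ∈ W ∧ j ∈ W) → M i j = 0) (ω : ℝ) (b : N → ℝ) :
    (completion (insert v W) (ω • Matrix.vecMulVec (starVec v N b) (starVec v N b) + M)).det =
      ω * (completion W M).det := by
  obtain ⟨U, hU, h⟩ := star_completion_factor hv hN hM ω b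
  rw [h, Matrix.det_mul, Matrix.det_mul, Matrix.det_mul, Matrix.det_transpose, hU,
    Matrix.det_diagonal, Finset.prod_update_of_mem (Finset.mem_univ v)]
  simp [mul_comm]

theorem posDef_completion_star_iff (hv : v ∉ W) (hN : N ⊆ W)
    (hM : ∀ i j, ¬ (i ∈ W ∧ j ∈ W) → M i j = 0) {ω : ℝ} (hω : 0 < ω) (b : N → ℝ) :
    (completion (insert v W) (ω • Matrix.vecMulVec (starVec v N b) (starVec v N b) + M)).PosDef ↔
      (completion W M).PosDef := by
  obtain ⟨U, hU, h⟩ := star_completion_factor hv hN hM ω b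
  have hUu : IsUnit U := (Matrix.isUnit_iff_isUnit_det U).2 (by rw [hU]; exact isUnit_one)
  set S : Matrix V V ℝ := Matrix.diagonal (Function.update 1 v (√ω)) with hS
  have hs : 0 < √ω := Real.sqrt_pos.2 hω
  have hSu : IsUnit S := by
    refine (Matrix.isUnit_iff_isUnit_det S).2 ?_
    rw [hS, Matrix.det_diagonal, Finset.prod_update_of_mem (Finset.mem_univ v)]
    simpa using hs.ne'
  -- Row and column `v` of `completion W M` are those of the identity, so scaling column `v` by `ω`
  -- equals scaling symmetrically by `√ω`. Both passages are then congruences by invertible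
  -- matrices, which preserve positive definiteness.
  have hX : completion W M * Matrix.diagonal (Function.update 1 v ω) =
      S * completion W M * star S := by
    rw [Matrix.star_eq_conjTranspose, hS, Matrix.diagonal_conjTranspose]
    ext i j
    simp only [Matrix.mul_diagonal, Matrix.diagonal_mul, star_trivial]
    by_cases hi : i = v <;> by_cases hj : j = v
    · subst hi; subst hj
      simp only [Function.update_self]
      rw [mul_comm (√ω), mul_assoc, Real.mul_self_sqrt hω.le]
    · simp [hi, hj, completion, hM v j (fun h => hv h.1), Matrix.diagonal_apply_ne' _ hj]
    · simp [hi, hj, completion, hM i v (fun h => hv h.2)]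
    · simp [hi, hj]
  rw [h, hX]
  have : U.transpose = star U := by simp [Matrix.star_eq_conjTranspose]
  rw [this, Matrix.IsUnit.posDef_star_right_conjugate_iff hUu,
    Matrix.IsUnit.posDef_star_right_conjugate_iff hSu]

end completion

/-! ### Translation and scaling of coordinates in partial integrals. -/

section translation

theorem lmarginal_translate {κ : Type*} [DecidableEq κ] (s : Finset κ)
    (F : (κ → ℝ) → ENNReal) (y : κ → ℝ) :
    lmarginal (fun _ => (volume : Measure ℝ)) s F y =
      lmarginal (fun _ => (volume : Measure ℝ)) s (fun x => F (y + x)) 0 := by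
  rw [lmarginal, lmarginal]
  have h := lintegral_add_left_eq_self (μ := (volume : Measure (s → ℝ)))
    (fun z => F (Function.updateFinset y s z)) (fun i => y i)
  rw [volume_pi] at h
  rw [← h]
  refine lintegral_congr fun z => ?_
  congr 1
  ext i
  by_cases hi : i ∈ s <;> simp [Function.updateFinset, hi]

theorem lmarginal_congr_of_eqOn {κ : Type*} [DecidableEq κ] (s : Finset κ)
    {F F' : (κ → ℝ) → ENNReal} (y : κ → ℝ) (h : ∀ x, (∀ i ∉ s, x i = y i) → F x = F' x) :
    lmarginal (fun _ => (volume : Measure ℝ)) s F y =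
      lmarginal (fun _ => (volume : Measure ℝ)) s F' y := by
  rw [lmarginal, lmarginal]
  refine lintegral_congr fun z => h _ fun i hi => ?_
  simp [Function.updateFinset, hi]

/-- The source of the Jacobian: used with the edges from `v` to `N` as `κ`, it replaces the edge
entries by `ω b`. -/
theorem lintegral_smul_equiv {ι κ : Type*} [Fintype ι] [Fintype κ] (e : ι ≃ κ) {ω : ℝ}
    (hω : 0 < ω) {H : (κ → ℝ) → ENNReal} (hH : Measurable H) :
    ∫⁻ a, H a = ENNReal.ofReal (ω ^ Fintype.card ι) *
      ∫⁻ b : ι → ℝ, H fun c => ω * b (e.symm c) := by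
  have h1 := (volume_measurePreserving_piCongrLeft (fun _ : κ => ℝ) e).lintegral_comp hH
  rw [← h1]
  have hm : Measurable fun b : ι → ℝ => H fun c => b (e.symm c) :=
    hH.comp (measurable_pi_lambda _ fun c => measurable_pi_apply _)
  have h2 : ∀ b : ι → ℝ, MeasurableEquiv.piCongrLeft (fun _ : κ => ℝ) e b =
      fun c => b (e.symm c) := by
    intro b
    ext c
    obtain ⟨i, rfl⟩ := e.surjective c
    simp [MeasurableEquiv.coe_piCongrLeft]
  simp_rw [h2]
  have h3 := lintegral_map (μ := (volume : Measure (ι → ℝ))) hm (measurable_const_smul ω)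
  rw [Measure.map_addHaar_smul _ hω.ne', lintegral_smul_measure] at h3
  simp only [Pi.smul_apply, smul_eq_mul, Module.finrank_fintype_fun_eq_card] at h3
  rw [← h3, ← mul_assoc, ← ENNReal.ofReal_mul (by positivity), abs_of_pos (by positivity),
    mul_inv_cancel₀ (by positivity), ENNReal.ofReal_one, one_mul]

end translation

/-! ### Measurability on the space of matrices. -/

section matrixMeasurable

variable {V : Type*} [Fintype V]

instance matrixBorelSpace : BorelSpace (Matrix V V ℝ) :=
  inferInstanceAs (BorelSpace (V → V → ℝ))

/-- The cone is the intersection of the closed set of positive semidefinite matrices with the open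
set of nonzero determinant. -/
theorem measurableSet_posDef [DecidableEq V] : MeasurableSet {M : Matrix V V ℝ | M.PosDef} := by
  have h1 : {M : Matrix V V ℝ | M.PosDef} =
      {M | M.PosSemidef} ∩ {M | M.det ≠ 0} := by
    ext M
    exact ⟨fun h => ⟨h.posSemidef, h.det_pos.ne'⟩, fun h => h.1.posDef_iff_det_ne_zero.2 h.2⟩
  have h2 : {M : Matrix V V ℝ | M.PosSemidef} =
      {M | M.conjTranspose = M} ∩ ⋂ x : V → ℝ, {M | 0 ≤ star x ⬝ᵥ M.mulVec x} := by
    ext M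
    simp only [Set.mem_ofPred_eq, Set.mem_inter_iff, Set.mem_iInter,
      Matrix.posSemidef_iff_dotProduct_mulVec]
    rfl
  have h3 : IsClosed {M : Matrix V V ℝ | M.PosSemidef} := by
    rw [h2]
    refine IsClosed.inter (isClosed_eq (by fun_prop) (by fun_prop)) (isClosed_iInter fun x => ?_)
    exact isClosed_le (by fun_prop) (by fun_prop)
  rw [h1]
  refine h3.measurableSet.inter (IsOpen.measurableSet ?_)
  exact isOpen_ne_fun (by fun_prop) (by fun_prop)

theorem measurable_det [DecidableEq V] : Measurable fun M : Matrix V V ℝ => M.det :=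
  (continuous_id.matrix_det).measurable

theorem measurable_trace_mul (Φ : Matrix V V ℝ) :
    Measurable fun M : Matrix V V ℝ => (M * Φ).trace := by
  refine Continuous.measurable ?_
  fun_prop

theorem measurable_add_left_matrix (A : Matrix V V ℝ) :
    Measurable fun M : Matrix V V ℝ => A + M :=
  (continuous_const.add continuous_id).measurable

end matrixMeasurable

/-! ### Free entries of matrices with the pattern of the graph. -/

section coordinates

variable {V : Type*} (g : SimpleGraph V)

theorem graphMatrix_add (x y : V ⊕ g.edgeSet → ℝ) :
    graphMatrix g (x + y) = graphMatrix g x + graphMatrix g y := by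
  ext i j
  simp only [graphMatrix, Matrix.of_apply, Matrix.add_apply, Pi.add_apply]
  split_ifs <;> simp

theorem graphMatrix_self (x : V ⊕ g.edgeSet → ℝ) (i : V) : graphMatrix g x i i = x (Sum.inl i) := by
  simp [graphMatrix]

theorem measurable_graphMatrix : Measurable (graphMatrix g) := by
  refine measurable_pi_lambda _ fun i => measurable_pi_lambda _ fun j => ?_
  simp only [graphMatrix, Matrix.of_apply]
  split_ifs <;> fun_prop

/-- A coordinate lies within `W` if its row and column do. -/
def Within (W : Finset V) : V ⊕ g.edgeSet → Prop
  | Sum.inl i => i ∈ W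
  | Sum.inr e => ∀ i ∈ e.1, i ∈ W

/-- The free entries of `u uᵀ`. -/
def outerCoords (u : V → ℝ) : V ⊕ g.edgeSet → ℝ
  | Sum.inl i => u i * u i
  | Sum.inr e => Sym2.lift ⟨fun i j => u i * u j, fun _ _ => mul_comm _ _⟩ e.1

/-- Since the support of `u` is complete, `u uᵀ` has no nonzero entry off the pattern and is
recovered from its free entries. -/
theorem graphMatrix_smul_outerCoords {u : V → ℝ}
    (hu : ∀ i j, i ≠ j → u i ≠ 0 → u j ≠ 0 → g.Adj i j) (ω : ℝ) :
    graphMatrix g (ω • outerCoords g u) = ω • Matrix.vecMulVec u u := by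
  ext i j
  simp only [graphMatrix, Matrix.of_apply, Matrix.smul_apply, Matrix.vecMulVec_apply,
    Pi.smul_apply, smul_eq_mul]
  split_ifs with h1 h2
  · subst h1; rfl
  · rfl
  · have : u i * u j = 0 := by
      by_contra h
      exact h2 (hu i j h1 (left_ne_zero_of_mul h) (right_ne_zero_of_mul h))
    rw [this, mul_zero]

theorem graphMatrix_eq_zero {W : Finset V} {x : V ⊕ g.edgeSet → ℝ}
    (hx : ∀ c, ¬ Within g W c → x c = 0) {i j : V} (h : ¬ (i ∈ W ∧ j ∈ W)) :
    graphMatrix g x i j = 0 := by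
  simp only [graphMatrix, Matrix.of_apply]
  split_ifs with h1 h2
  · subst h1
    exact hx _ fun h' => h ⟨h', h'⟩
  · exact hx _ fun h' => h ⟨h' i (by simp), h' j (by simp)⟩
  · rfl

end coordinates

/-! ### Factorization of the weight at a simplicial vertex. -/

section partialIntegral

variable {V : Type*} [Fintype V] [DecidableEq V] (g : SimpleGraph V)

/-- The unnormalized graph Wishart density of the block indexed by `W`, as a function of a matrix
supported on `W × W`. -/
noncomputable def blockDensity (W : Finset V) (δ : ℝ) (Φ : Matrix V V ℝ) :
    Matrix V V ℝ → ENNReal :=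
  Set.indicator {M | (completion W M).PosDef} fun M =>
    ENNReal.ofReal ((completion W M).det ^ ((δ - 2) / 2) * Real.exp (-(1 / 2) * (M * Φ).trace))

theorem measurable_completion (W : Finset V) : Measurable (completion W) :=
  (continuous_id.add continuous_const).measurable

theorem measurable_blockDensity (W : Finset V) (δ : ℝ) (Φ : Matrix V V ℝ) :
    Measurable (blockDensity W δ Φ) := by
  refine Measurable.indicator ?_ (measurable_completion W measurableSet_posDef)
  refine Measurable.ennreal_ofReal (Measurable.mul ?_ ?_)
  · exact (measurable_det.comp (measurable_completion W)).pow_const _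
  · exact ((measurable_trace_mul Φ).const_mul _).exp

/-- The determinant and positivity come from the unipotent factorization; the trace is additive, and
`tr (u uᵀ Φ) = uᵀ Φ u`. -/
theorem blockDensity_star {v : V} {N W : Finset V} {M : Matrix V V ℝ} (hv : v ∉ W) (hN : N ⊆ W)
    (hM : ∀ i j, ¬ (i ∈ W ∧ j ∈ W) → M i j = 0) (δ : ℝ) (Φ : Matrix V V ℝ) {ω : ℝ} (hω : 0 < ω)
    (b : N → ℝ) :
    blockDensity (insert v W) δ Φ
        (ω • Matrix.vecMulVec (starVec v N b) (starVec v N b) + M) =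
      ENNReal.ofReal (ω ^ ((δ - 2) / 2) *
        Real.exp (-(1 / 2) * (ω * (starVec v N b ⬝ᵥ Φ.mulVec (starVec v N b))))) *
        blockDensity W δ Φ M := by
  have hiff := posDef_completion_star_iff hv hN hM hω b
  by_cases hp : (completion W M).PosDef
  · rw [blockDensity, Set.indicator_of_mem (by exact hiff.2 hp), blockDensity,
      Set.indicator_of_mem (by exact hp), det_completion_star hv hN hM,
      ← ENNReal.ofReal_mul (by positivity), Real.mul_rpow hω.le hp.det_pos.le]
    congr 1
    have ht : (Matrix.vecMulVec (starVec v N b) (starVec v N b) * Φ).trace =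
        starVec v N b ⬝ᵥ Φ.mulVec (starVec v N b) := by
      rw [Matrix.vecMulVec_mul, Matrix.trace_vecMulVec, Matrix.dotProduct_mulVec, dotProduct_comm]
    rw [Matrix.add_mul, Matrix.smul_mul, Matrix.trace_add, Matrix.trace_smul, ht, smul_eq_mul,
      mul_add, Real.exp_add]
    ring
  · rw [blockDensity, Set.indicator_of_notMem (by exact fun h => hp (hiff.1 h)), blockDensity,
      Set.indicator_of_notMem (by exact hp), mul_zero]

open Classical in
/-- The integral of `f` against the unnormalized graph Wishart density of the block indexed by `W`:
the coordinates outside `W` are set to zero. -/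
noncomputable def blockIntegral (W : Finset V) (δ : ℝ) (Φ : Matrix V V ℝ)
    (f : Matrix V V ℝ → ENNReal) : ENNReal :=
  lmarginal (fun _ => (volume : Measure ℝ)) (Finset.univ.filter (Within g W))
    (fun x => blockDensity W δ Φ (graphMatrix g x) * f (graphMatrix g x)) 0

theorem blockIntegral_empty (δ : ℝ) (Φ : Matrix V V ℝ) (f : Matrix V V ℝ → ENNReal) :
    blockIntegral g ∅ δ Φ f = f 0 := by
  classical
  have h0 : Finset.univ.filter (Within g (∅ : Finset V)) = ∅ := by
    ext c
    simp only [Finset.mem_filter, Finset.mem_univ, true_and, Finset.notMem_empty, iff_false]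
    rcases c with i | ⟨e, he⟩
    · simp [Within]
    · induction e with | _ i j => exact fun h => Finset.notMem_empty i (h i (by simp))
  have h1 : graphMatrix g (0 : V ⊕ g.edgeSet → ℝ) = 0 := by
    ext i j; simp [graphMatrix]
  have h2 : completion (∅ : Finset V) (0 : Matrix V V ℝ) = 1 := by
    simp [completion]
  rw [blockIntegral]
  convert congrFun (lmarginal_empty (μ := fun _ : V ⊕ g.edgeSet => (volume : Measure ℝ))
    (fun x => blockDensity ∅ δ Φ (graphMatrix g x) * f (graphMatrix g x))) 0 using 1
  · congr
  · rw [h1, blockDensity, Set.indicator_of_mem (by simp [h2, Matrix.PosDef.one]), h2]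
    simp

/-- Splitting off a vertex `v` whose neighbours `N` in `W` form a clique: the matrix is the sum of
`ω u uᵀ` with `u = starVec v N b` and of a matrix supported on `W × W`. -/
theorem blockIntegral_insert {v : V} {N W : Finset V} (hv : v ∉ W) (hN : N ⊆ W)
    (hadj : ∀ i ∈ W, g.Adj v i ↔ i ∈ N) (hclique : g.IsClique (N : Set V)) (δ : ℝ)
    (Φ : Matrix V V ℝ) {f : Matrix V V ℝ → ENNReal} (hf : Measurable f) :
    blockIntegral g (insert v W) δ Φ f =
      ∫⁻ ω in Set.Ioi (0 : ℝ), ∫⁻ b : N → ℝ, ENNReal.ofReal (ω ^ ((δ - 2) / 2 + N.card) *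
        Real.exp (-(1 / 2) * (ω * (starVec v N b ⬝ᵥ Φ.mulVec (starVec v N b))))) *
        blockIntegral g W δ Φ fun M =>
          f (ω • Matrix.vecMulVec (starVec v N b) (starVec v N b) + M) := by
  classical
  set κ := V ⊕ g.edgeSet with hκ
  set F : (κ → ℝ) → ENNReal := fun x =>
    blockDensity (insert v W) δ Φ (graphMatrix g x) * f (graphMatrix g x) with hF
  have hFm : Measurable F :=
    ((measurable_blockDensity _ δ Φ).comp (measurable_graphMatrix g)).mul
      (hf.comp (measurable_graphMatrix g))
  have hadjN : ∀ i : N, g.Adj v i := fun i => (hadj i (hN i.2)).2 i.2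
  set s : Finset κ := Finset.univ.filter (Within g W) with hs
  set edge : N → κ := fun i => Sum.inr ⟨s(v, i), g.mem_edgeSet.2 (hadjN i)⟩ with hedge
  set E : Finset κ := Finset.univ.image edge with hE
  have hvs : Sum.inl v ∉ E ∪ s := by
    simp [hE, hedge, hs, Within, hv]
  have hEs : Disjoint E s := by
    rw [Finset.disjoint_left]
    intro c hc hcs
    obtain ⟨i, -, rfl⟩ := Finset.mem_image.1 hc
    exact hv ((Finset.mem_filter.1 hcs).2 v (by simp))
  -- The free entries within `insert v W` are the diagonal entry at `v`, the edges from `v` to `N`,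
  -- and the entries within `W`.
  have hsplit : Finset.univ.filter (Within g (insert v W)) = insert (Sum.inl v) (E ∪ s) := by
    ext c
    simp only [Finset.mem_filter, Finset.mem_univ, true_and, Finset.mem_insert, Finset.mem_union]
    constructor
    · intro hc
      rcases c with i | ⟨e, he⟩
      · rcases Finset.mem_insert.1 hc with rfl | hi
        · exact Or.inl rfl
        · exact Or.inr (Or.inr (Finset.mem_filter.2 ⟨Finset.mem_univ _, hi⟩))
      · right
        by_cases hve : v ∈ e
        · left
          obtain ⟨j, rfl⟩ := hve
          have hvj : g.Adj v j := he
          have hj : j ∈ W := (Finset.mem_insert.1 (hc j (by simp))).resolve_left hvj.ne'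
          exact Finset.mem_image.2 ⟨⟨j, (hadj j hj).1 hvj⟩, Finset.mem_univ _, rfl⟩
        · right
          refine Finset.mem_filter.2 ⟨Finset.mem_univ _, fun i hi => ?_⟩
          exact (Finset.mem_insert.1 (hc i hi)).resolve_left fun h => hve (h ▸ hi)
    · rintro (rfl | hc | hc)
      · exact Finset.mem_insert_self _ _
      · obtain ⟨i, -, rfl⟩ := Finset.mem_image.1 hc
        intro j hj
        rcases Sym2.mem_iff.1 hj with rfl | rfl
        · exact Finset.mem_insert_self _ _
        · exact Finset.mem_insert_of_mem (hN i.2)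
      · have hc := (Finset.mem_filter.1 hc).2
        rcases c with i | e
        · exact Finset.mem_insert_of_mem hc
        · exact fun i hi => Finset.mem_insert_of_mem (hc i hi)
  have hinj : Function.Injective edge := by
    intro i j hij
    have h1 : s(v, i.1) = s(v, j.1) := congrArg Subtype.val (Sum.inr.inj hij)
    exact Subtype.ext (Sym2.congr_right.1 h1)
  let eqv : N ≃ E := Equiv.ofBijective
    (fun i => ⟨edge i, Finset.mem_image_of_mem _ (Finset.mem_univ i)⟩)
    ⟨fun i j h => hinj (congrArg Subtype.val h), fun ⟨c, hc⟩ => by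
      obtain ⟨i, -, rfl⟩ := Finset.mem_image.1 hc
      exact ⟨i, rfl⟩⟩
  let J : (κ → ℝ) → ENNReal := lmarginal (fun _ => (volume : Measure ℝ)) s F
  have hJm : Measurable J := hFm.lmarginal _
  have h1 : blockIntegral g (insert v W) δ Φ f =
      ∫⁻ ω : ℝ, ∫⁻ a : E → ℝ,
        J (Function.updateFinset (Function.update 0 (Sum.inl v) ω) E a) := by
    have : blockIntegral g (insert v W) δ Φ f = lmarginal (fun _ => (volume : Measure ℝ))
        (insert (Sum.inl v) (E ∪ s)) F 0 := by
      rw [blockIntegral, ← hsplit]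
    rw [this, lmarginal_insert _ hFm hvs, lmarginal_union _ _ hFm hEs]
    rfl
  -- The variable `ω` is the diagonal entry at `v`, so the density vanishes unless it is positive.
  have hneg : ∀ ω : ℝ, ω ≤ 0 → ∀ a : E → ℝ,
      J (Function.updateFinset (Function.update 0 (Sum.inl v) ω) E a) = 0 := by
    intro ω hω a
    have hz := lmarginal_congr_of_eqOn s (F := F) (F' := fun _ => 0)
      (Function.updateFinset (Function.update 0 (Sum.inl v) ω) E a) ?_
    · rw [show J _ = _ from hz]; simp [lmarginal]
    · intro x hx
      have hxv : x (Sum.inl v) = ω := by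
        rw [hx _ fun h => hvs (Finset.mem_union_right _ h)]
        rw [Function.updateFinset, dif_neg fun h => hvs (Finset.mem_union_left s h),
          Function.update_self]
      have hnp : ¬ (completion (insert v W) (graphMatrix g x)).PosDef := by
        intro hp
        have := hp.diag_pos (i := v)
        rw [completion, Matrix.add_apply, graphMatrix_self, hxv] at this
        simp at this
        linarith
      simp only [hF]
      rw [blockDensity, Set.indicator_of_notMem (by exact hnp), zero_mul]
  rw [h1, ← lintegral_add_compl _ (measurableSet_Ioi (a := (0 : ℝ))), Set.compl_Ioi,
    setLIntegral_congr_fun (g := fun _ => 0) measurableSet_Iic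
      (fun ω hω => by simp [hneg ω hω]), lintegral_zero, add_zero]
  refine setLIntegral_congr_fun measurableSet_Ioi fun ω hω => ?_
  have hω : 0 < ω := hω
  have hJu : Measurable fun a : E → ℝ =>
      J (Function.updateFinset (Function.update 0 (Sum.inl v) ω) E a) :=
    hJm.comp measurable_updateFinset
  rw [lintegral_smul_equiv eqv hω hJu, ← lintegral_const_mul' _ _ ENNReal.ofReal_ne_top]
  refine lintegral_congr fun b => ?_
  set u := starVec v N b with hu
  have huN : ∀ i : N, u i = b i := fun i => by
    have : (i : V) ≠ v := fun h => hv (h ▸ hN i.2)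
    simp [hu, starVec, extendVec, this]
  have huv : u v = 1 := by
    have : v ∉ N := fun h => hv (hN h)
    simp [hu, starVec, extendVec, this]
  have hu0 : ∀ i, i ∉ insert v N → u i = 0 := by
    intro i hi
    rw [Finset.mem_insert, not_or] at hi
    simp [hu, starVec, extendVec, hi.1, hi.2]
  have hstar : ∀ i j, i ≠ j → u i ≠ 0 → u j ≠ 0 → g.Adj i j := by
    intro i j hij hi hj
    have hi : i ∈ insert v N := by_contra fun h => hi (hu0 i h)
    have hj : j ∈ insert v N := by_contra fun h => hj (hu0 j h)
    rcases Finset.mem_insert.1 hi with hi' | hiN <;> rcases Finset.mem_insert.1 hj with hj' | hjN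
    · exact absurd (hi'.trans hj'.symm) hij
    · exact hi' ▸ hadjN ⟨j, hjN⟩
    · exact hj' ▸ (hadjN ⟨i, hiN⟩).symm
    · exact hclique hiN hjN hij
  -- Off `W` the coordinates already are those of `ω u uᵀ`. Within `W` they are integrated over all
  -- reals, so translation invariance absorbs the entries of `ω u uᵀ` there and makes `M` the new
  -- variable.
  have hagree : ∀ c ∉ s, Function.updateFinset (Function.update (0 : κ → ℝ) (Sum.inl v) ω) E
      (fun c => ω * b (eqv.symm c)) c = (ω • outerCoords g u) c := by
    intro c hc
    by_cases hcE : c ∈ E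
    · obtain ⟨i, hi⟩ := eqv.surjective ⟨c, hcE⟩
      have hci : c = edge i := congrArg Subtype.val hi.symm
      rw [Function.updateFinset, dif_pos hcE, ← hi, Equiv.symm_apply_apply, hci]
      simp [hedge, outerCoords, huv, huN]
    · rw [Function.updateFinset, dif_neg hcE]
      by_cases hcv : c = Sum.inl v
      · subst hcv
        simp [outerCoords, huv]
      · rw [Function.update_of_ne hcv]
        have hc' : ¬ Within g (insert v N) c := by
          intro h
          have : c ∈ Finset.univ.filter (Within g (insert v W)) := by
            refine Finset.mem_filter.2 ⟨Finset.mem_univ _, ?_⟩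
            rcases c with i | e
            · exact Finset.insert_subset_insert v hN h
            · exact fun i hi => Finset.insert_subset_insert v hN (h i hi)
          rw [hsplit, Finset.mem_insert, Finset.mem_union] at this
          tauto
        rcases c with i | ⟨e, he⟩
        · simp [outerCoords, hu0 i hc']
        · induction e with
          | _ i j =>
            have : u i * u j = 0 := by
              by_contra h
              refine hc' fun k hk => by_contra fun hk' => ?_
              rcases Sym2.mem_iff.1 hk with rfl | rfl
              · exact left_ne_zero_of_mul h (hu0 _ hk')
              · exact right_ne_zero_of_mul h (hu0 _ hk')
            simp [outerCoords, this]
  have h2 : J (Function.updateFinset (Function.update (0 : κ → ℝ) (Sum.inl v) ω) E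
      fun c => ω * b (eqv.symm c)) =
      lmarginal (fun _ => (volume : Measure ℝ)) s (fun x => F (ω • outerCoords g u + x)) 0 := by
    rw [← lmarginal_translate]
    exact lmarginal_congr _ F hagree
  have h3 : lmarginal (fun _ => (volume : Measure ℝ)) s
      (fun x => F (ω • outerCoords g u + x)) 0 =
      lmarginal (fun _ => (volume : Measure ℝ)) s (fun x => ENNReal.ofReal (ω ^ ((δ - 2) / 2) *
        Real.exp (-(1 / 2) * (ω * (u ⬝ᵥ Φ.mulVec u)))) *
        (blockDensity W δ Φ (graphMatrix g x) *
          f (ω • Matrix.vecMulVec u u + graphMatrix g x))) 0 := by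
    refine lmarginal_congr_of_eqOn s 0 fun x hx => ?_
    have hx0 : ∀ c, ¬ Within g W c → x c = 0 := fun c hc =>
      hx c fun h => hc (Finset.mem_filter.1 h).2
    simp only [hF]
    rw [graphMatrix_add, graphMatrix_smul_outerCoords g hstar, hu,
      blockDensity_star hv hN (fun i j h => graphMatrix_eq_zero g hx0 h) δ Φ hω b, mul_assoc]
  rw [h2, h3, lmarginal, lintegral_const_mul' _ _ ENNReal.ofReal_ne_top, ← mul_assoc,
    ← ENNReal.ofReal_mul (by positivity)]
  congr 2
  rw [Real.rpow_add hω, Real.rpow_natCast, Fintype.card_coe]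
  ring

end partialIntegral

/-! ### Induction on the vertex set: block laws and their means. -/

section blockLaw

variable {V : Type*} [Fintype V] [DecidableEq V] (g : SimpleGraph V)

/-- The graph Wishart weight of the block indexed by `W` is a positive finite multiple of a
probability law with mean `A`. -/
def HasBlockLaw (δ : ℝ) (Φ : Matrix V V ℝ) (W : Finset V) (A : Matrix V V ℝ) : Prop :=
  ∃ (c : ENNReal) (P : Measure (Matrix V V ℝ)), c ≠ 0 ∧ c ≠ ⊤ ∧ IsProbabilityMeasure P ∧
    (∀ f : Matrix V V ℝ → ENNReal, Measurable f → blockIntegral g W δ Φ f = c * ∫⁻ M, f M ∂P) ∧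
    (∀ i j, Integrable (fun M => M i j) P) ∧ ∀ i j, ∫ M, M i j ∂P = A i j

theorem hasBlockLaw_empty (δ : ℝ) (Φ : Matrix V V ℝ) : HasBlockLaw g δ Φ ∅ 0 := by
  refine ⟨1, Measure.dirac 0, one_ne_zero, ENNReal.one_ne_top, inferInstance, ?_, ?_, ?_⟩
  · intro f hf
    rw [blockIntegral_empty, lintegral_dirac' _ hf, one_mul]
  · intro i j
    exact integrable_dirac' (measurable_matrix_apply i j).stronglyMeasurable (by simp)
  · intro i j
    rw [integral_dirac' _ _ (measurable_matrix_apply i j).stronglyMeasurable]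

variable {g} {δ : ℝ} {Φ : Matrix V V ℝ} {W N : Finset V} {A : Matrix V V ℝ} {v : V}

/-- The factorization makes the new law that of a sum of two independent matrices, the star part and
the old block, so constants multiply and means add. -/
theorem HasBlockLaw.insert (h : HasBlockLaw g δ Φ W A) (hδ : 0 < δ) (hΦ : Φ.PosDef) (hv : v ∉ W)
    (hN : N ⊆ W) (hadj : ∀ i ∈ W, g.Adj v i ↔ i ∈ N) (hclique : g.IsClique (N : Set V)) :
    HasBlockLaw g δ Φ (insert v W) (A + (cliqueTerm δ Φ (insert v N) - cliqueTerm δ Φ N)) := by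
  obtain ⟨c, P, hc0, hct, hP, hPf, hPi, hPm⟩ := h
  obtain ⟨d, ρ, hd0, hdt, hρ, hρf, hρi, hρm⟩ :=
    exists_starLaw hΦ (fun h' => hv (hN h') : v ∉ N) hδ
  have hadd : Measurable fun p : Matrix V V ℝ × Matrix V V ℝ => p.1 + p.2 :=
    measurable_pi_lambda _ fun i => measurable_pi_lambda _ fun j =>
      ((measurable_matrix_apply i j).comp measurable_fst).add
        ((measurable_matrix_apply i j).comp measurable_snd)
  refine ⟨d * c, Measure.map (fun p => p.1 + p.2) (ρ.prod P), mul_ne_zero hd0 hc0,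
    ENNReal.mul_ne_top hdt hct, Measure.isProbabilityMeasure_map hadd.aemeasurable, ?_, ?_, ?_⟩
  · intro f hf
    have hfa : Measurable fun p : Matrix V V ℝ × Matrix V V ℝ => f (p.1 + p.2) := hf.comp hadd
    rw [blockIntegral_insert g hv hN hadj hclique δ Φ hf]
    have e : ∀ X : Matrix V V ℝ, blockIntegral g W δ Φ (fun M => f (X + M)) =
        c * ∫⁻ M, f (X + M) ∂P := fun X => hPf _ (hf.comp (measurable_add_left_matrix X))
    simp_rw [e]
    have hm : Measurable fun X : Matrix V V ℝ => c * ∫⁻ M, f (X + M) ∂P :=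
      (Measurable.lintegral_prod_right' hfa).const_mul c
    rw [hρf _ hm, lintegral_const_mul' _ _ hct, lintegral_map hf hadd,
      lintegral_prod _ hfa.aemeasurable, mul_assoc]
  · intro i j
    rw [integrable_map_measure (measurable_matrix_apply i j).aestronglyMeasurable
      hadd.aemeasurable]
    exact ((hρi i j).comp_fst P).add ((hPi i j).comp_snd ρ)
  · intro i j
    rw [integral_map hadd.aemeasurable (measurable_matrix_apply i j).aestronglyMeasurable]
    simp only [Matrix.add_apply]
    rw [integral_add ((hρi i j).comp_fst P) ((hPi i j).comp_snd ρ),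
      integral_fun_fst (fun M : Matrix V V ℝ => M i j),
      integral_fun_snd (fun M : Matrix V V ℝ => M i j), hρm, hPm]
    simp [add_comm]

end blockLaw

/-! ### Combinatorics of perfect sequences. -/

section cliqueSequence

variable {V : Type*} [DecidableEq V] {g : SimpleGraph V} {k : ℕ} {C : Fin k → Finset V}

/-- The union of the first `n` sets of a sequence. -/
def initialUnion (C : Fin k → Finset V) (n : ℕ) : Finset V :=
  (Finset.univ.filter fun l : Fin k => l.val < n).biUnion C

theorem mem_initialUnion {n : ℕ} {i : V} :
    i ∈ initialUnion C n ↔ ∃ l : Fin k, l.val < n ∧ i ∈ C l := by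
  simp [initialUnion]

theorem mem_separator {j : Fin k} {i : V} :
    i ∈ separator C j ↔ i ∈ initialUnion C j.val ∧ i ∈ C j := by
  rw [mem_initialUnion]
  simp [separator]

theorem IsPerfectCliqueSequence.isClique (hC : IsPerfectCliqueSequence g C) (j : Fin k) :
    g.IsClique (C j : Set V) :=
  ((hC.mem_range_iff (C j)).1 ⟨j, rfl⟩).prop

theorem IsPerfectCliqueSequence.exists_subset [Finite V] (hC : IsPerfectCliqueSequence g C)
    {s : Finset V} (hs : g.IsClique (s : Set V)) : ∃ j, s ⊆ C j := by
  obtain ⟨t, hst, ht⟩ := Finite.exists_le_maximal (p := fun t : Finset V => g.IsClique (t : Set V))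
    hs
  obtain ⟨j, rfl⟩ := (hC.mem_range_iff t).2 ht
  exact ⟨j, hst⟩

/-- A vertex of `C j` outside the earlier cliques has all its neighbours in the earlier cliques
inside `C j`. -/
theorem IsPerfectCliqueSequence.mem_of_adj [Finite V] (hC : IsPerfectCliqueSequence g C)
    {j : Fin k} {v i : V} (hvj : v ∈ C j) (hv : v ∉ initialUnion C j.val)
    (hi : i ∈ initialUnion C j.val) (hadj : g.Adj v i) : i ∈ C j := by
  -- Descent on the index `m` of a clique containing both vertices. It cannot be below `j`, because
  -- `v` is new at `j`. If it is above `j`, both vertices lie in the separator of `C m`, hence in a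
  -- clique of smaller index.
  have key : ∀ m : ℕ, ∀ hm : m < k, v ∈ C ⟨m, hm⟩ → i ∈ C ⟨m, hm⟩ → i ∈ C j := by
    intro m
    induction m using Nat.strong_induction_on with
    | _ m ih =>
      intro hm hvm him
      rcases lt_trichotomy m j.val with hlt | heq | hgt
      · exact absurd (mem_initialUnion.2 ⟨⟨m, hm⟩, hlt, hvm⟩) hv
      · have : (⟨m, hm⟩ : Fin k) = j := Fin.ext heq
        exact this ▸ him
      · obtain ⟨l, hl, hsub⟩ := hC.separator_subset ⟨m, hm⟩ (Nat.zero_lt_of_lt hgt)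
        obtain ⟨l', hl', hil'⟩ := mem_initialUnion.1 hi
        refine ih l.val hl l.isLt (hsub (mem_separator.2 ⟨?_, hvm⟩))
          (hsub (mem_separator.2 ⟨?_, him⟩))
        · exact mem_initialUnion.2 ⟨j, hgt, hvj⟩
        · exact mem_initialUnion.2 ⟨l', hl'.trans hgt, hil'⟩
  have hpair : g.IsClique (({v, i} : Finset V) : Set V) := by
    rw [Finset.coe_pair, SimpleGraph.isClique_pair]
    exact fun _ => hadj
  obtain ⟨m, hm⟩ := hC.exists_subset hpair
  exact key m.val m.isLt (hm (by simp)) (hm (by simp))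

end cliqueSequence

/-! ### Summation over the cliques and the posterior mean. -/

section assembly

variable {V : Type*} [Fintype V] [DecidableEq V] {g : SimpleGraph V} {k : ℕ} {C : Fin k → Finset V}
  {δ : ℝ} {Φ : Matrix V V ℝ}

theorem HasBlockLaw.add_clique (hC : IsPerfectCliqueSequence g C) (hδ : 0 < δ) (hΦ : Φ.PosDef)
    (j : Fin k) {A : Matrix V V ℝ} (h : HasBlockLaw g δ Φ (initialUnion C j.val) A) :
    HasBlockLaw g δ Φ (initialUnion C (j.val + 1))
      (A + (cliqueTerm δ Φ (C j) - cliqueTerm δ Φ (separator C j))) := by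
  -- The new vertices of `C j` are added one by one. After adding `R`, the earlier neighbours of the
  -- next vertex are exactly `separator C j ∪ R`, a subset of the clique `C j`, so consecutive
  -- differences telescope.
  have key : ∀ R : Finset V, R ⊆ C j \ initialUnion C j.val →
      HasBlockLaw g δ Φ (initialUnion C j.val ∪ R)
        (A + (cliqueTerm δ Φ (separator C j ∪ R) - cliqueTerm δ Φ (separator C j))) := by
    intro R
    induction R using Finset.induction with
    | empty => intro _; simpa using h
    | insert v R hvR ih =>
      intro hsub
      have hR : R ⊆ C j \ initialUnion C j.val := (Finset.subset_insert v R).trans hsub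
      obtain ⟨hvj, hvW⟩ := Finset.mem_sdiff.1 (hsub (Finset.mem_insert_self v R))
      have hSR : separator C j ∪ R ⊆ C j := Finset.union_subset
        (fun i hi => (mem_separator.1 hi).2) fun i hi => (Finset.mem_sdiff.1 (hR hi)).1
      have hv : v ∉ initialUnion C j.val ∪ R := by simp [hvW, hvR]
      have hN : separator C j ∪ R ⊆ initialUnion C j.val ∪ R :=
        Finset.union_subset_union_left fun i hi => (mem_separator.1 hi).1
      have hadj : ∀ i ∈ initialUnion C j.val ∪ R, g.Adj v i ↔ i ∈ separator C j ∪ R := by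
        intro i hi
        constructor
        · intro hvi
          rcases Finset.mem_union.1 hi with hi | hi
          · exact Finset.mem_union_left _
              (mem_separator.2 ⟨hi, hC.mem_of_adj hvj hvW hi hvi⟩)
          · exact Finset.mem_union_right _ hi
        · intro hiS
          exact hC.isClique j hvj (hSR hiS) fun hvi => hv (hvi ▸ hi)
      have := (ih hR).insert hδ hΦ hv hN hadj ((hC.isClique j).subset (by exact_mod_cast hSR))
      rw [Finset.union_insert, Finset.union_insert]
      convert this using 1
      abel
  have hfin := key _ subset_rfl
  have e1 : initialUnion C j.val ∪ (C j \ initialUnion C j.val) = initialUnion C (j.val + 1) := by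
    rw [Finset.union_sdiff_self_eq_union]
    ext i
    simp only [Finset.mem_union, mem_initialUnion, Nat.lt_succ_iff_lt_or_eq]
    constructor
    · rintro (⟨l, hl, hi⟩ | hi)
      · exact ⟨l, Or.inl hl, hi⟩
      · exact ⟨j, Or.inr rfl, hi⟩
    · rintro ⟨l, hl | hl, hi⟩
      · exact Or.inl ⟨l, hl, hi⟩
      · exact Or.inr (Fin.ext hl ▸ hi)
  have e2 : separator C j ∪ (C j \ initialUnion C j.val) = C j := by
    ext i
    simp only [Finset.mem_union, mem_separator, Finset.mem_sdiff]
    tauto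
  rwa [e1, e2] at hfin

theorem hasBlockLaw_initialUnion (hC : IsPerfectCliqueSequence g C) (hδ : 0 < δ) (hΦ : Φ.PosDef)
    (n : ℕ) (hn : n ≤ k) :
    HasBlockLaw g δ Φ (initialUnion C n)
      (∑ i with i.val < n, (cliqueTerm δ Φ (C i) - cliqueTerm δ Φ (separator C i))) := by
  induction n with
  | zero => simpa [initialUnion] using hasBlockLaw_empty g δ Φ
  | succ n ih =>
    have hnk : n < k := hn
    have h := HasBlockLaw.add_clique hC hδ hΦ ⟨n, hnk⟩ (ih hnk.le)
    have e : (Finset.univ.filter fun i : Fin k => i.val < n + 1) =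
        insert ⟨n, hnk⟩ (Finset.univ.filter fun i : Fin k => i.val < n) := by
      ext i
      simp only [Finset.mem_filter, Finset.mem_univ, true_and, Finset.mem_insert, Fin.ext_iff]
      omega
    rw [e, Finset.sum_insert (by simp), add_comm (cliqueTerm δ Φ _ - _)]
    exact h

theorem hasBlockLaw_univ (hC : IsPerfectCliqueSequence g C) (hδ : 0 < δ) (hΦ : Φ.PosDef) :
    HasBlockLaw g δ Φ Finset.univ
      (∑ i, cliqueTerm δ Φ (C i) - ∑ i with 0 < i.val, cliqueTerm δ Φ (separator C i)) := by
  have h := hasBlockLaw_initialUnion hC hδ hΦ k le_rfl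
  have e1 : initialUnion C k = Finset.univ := by
    refine Finset.eq_univ_of_forall fun i => ?_
    obtain ⟨j, hj⟩ := hC.exists_subset (s := {i}) (by simp)
    exact mem_initialUnion.2 ⟨j, j.isLt, hj (Finset.mem_singleton_self i)⟩
  have e2 : (Finset.univ.filter fun i : Fin k => i.val < k) = Finset.univ :=
    Finset.filter_true_of_mem fun i _ => i.isLt
  -- At index zero there are no earlier cliques; the separator is empty and its padded term is zero.
  have e3 : ∑ i, cliqueTerm δ Φ (separator C i) =
      ∑ i with 0 < i.val, cliqueTerm δ Φ (separator C i) := by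
    refine (Finset.sum_filter_of_ne fun i _ hi => ?_).symm
    by_contra h0
    refine hi ?_
    have hS : separator C i = ∅ := by
      refine Finset.eq_empty_of_forall_notMem fun x hx => ?_
      obtain ⟨l, hl, -⟩ := mem_initialUnion.1 (mem_separator.1 hx).1
      omega
    rw [hS]
    ext a b
    simp [cliqueTerm, pad]
  rw [e1, e2, Finset.sum_sub_distrib, e3] at h
  exact h

open Classical in
theorem blockIntegral_univ (g : SimpleGraph V) (δ : ℝ) (Φ : Matrix V V ℝ)
    (f : Matrix V V ℝ → ENNReal) :
    blockIntegral g Finset.univ δ Φ f =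
      ∫⁻ x, graphWishartDensity g δ Φ x * f (graphMatrix g x) := by
  have e : Finset.univ.filter (Within g (Finset.univ : Finset V)) = Finset.univ :=
    Finset.filter_true_of_mem fun c _ => by
      rcases c with i | e
      · exact Finset.mem_univ i
      · exact fun i _ => Finset.mem_univ i
  have hcomp : ∀ M : Matrix V V ℝ, completion Finset.univ M = M := fun M => by
    simp [completion]
  rw [blockIntegral, e, lmarginal_univ]
  refine lintegral_congr fun x => ?_
  simp only [blockDensity, graphWishartDensity, hcomp, Set.indicator_apply]
  rfl

/-- Testing against `1` identifies `c` as the total mass, so the normalization in `graphWishart` is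
by a positive finite number; testing against indicators then gives equality of measures. -/
theorem graphWishart_eq_of_blockIntegral {c : ENNReal} {P : Measure (Matrix V V ℝ)}
    [IsProbabilityMeasure P] (hc0 : c ≠ 0) (hct : c ≠ ⊤)
    (h : ∀ f : Matrix V V ℝ → ENNReal, Measurable f →
      blockIntegral g Finset.univ δ Φ f = c * ∫⁻ M, f M ∂P) :
    graphWishart g δ Φ = P := by
  have hmass := h 1 measurable_const
  rw [blockIntegral_univ] at hmass
  simp only [Pi.one_apply, mul_one, lintegral_const, measure_univ] at hmass
  ext s hs
  have hG := measurable_graphMatrix g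
  have hs1 := h (s.indicator 1) (measurable_const.indicator hs)
  rw [blockIntegral_univ, lintegral_indicator_one hs] at hs1
  rw [graphWishart, hmass, Measure.smul_apply, Measure.map_apply hG hs,
    withDensity_apply _ (hG hs), ← lintegral_indicator (hG hs), smul_eq_mul]
  have e : ∀ x, (graphMatrix g ⁻¹' s).indicator (graphWishartDensity g δ Φ) x =
      graphWishartDensity g δ Φ x * s.indicator 1 (graphMatrix g x) := by
    intro x
    by_cases hx : graphMatrix g x ∈ s
    · rw [Set.indicator_of_mem (by exact hx), Set.indicator_of_mem hx, Pi.one_apply, mul_one]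
    · rw [Set.indicator_of_notMem (by exact hx), Set.indicator_of_notMem hx, mul_zero]
  simp_rw [e]
  rw [hs1, ← mul_assoc, ENNReal.inv_mul_cancel hc0 hct, one_mul]

end assembly

theorem theorem3 {V : Type*} [Fintype V] [DecidableEq V] (g : SimpleGraph V)
    (hg : Decomposable g) {k : ℕ} (C : Fin k → Finset V) (hC : IsPerfectCliqueSequence g C)
    (δs : ℝ) (hδs : 0 < δs) (Φs : Matrix V V ℝ) (hΦs : Φs.PosDef)
    {S : Type*} [MeasurableSpace S] (posterior : Measure S) (Ω : S → Matrix V V ℝ)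
    (hΩ : ProbabilityTheory.HasLaw Ω (graphWishart g δs Φs) posterior) :
    IsProbabilityMeasure posterior ∧
    (∀ i j, Integrable (fun s => Ω s i j) posterior) ∧
    (Matrix.of fun i j => ∫ s, Ω s i j ∂posterior) =
      ∑ i, pad ((δs + ((C i).card : ℝ) - 1) • (block Φs (C i))⁻¹) -
      ∑ i with 0 < i.val, pad ((δs + ((separator C i).card : ℝ) - 1) •
        (block Φs (separator C i))⁻¹) := by
  obtain ⟨c, P, hc0, hct, hP, hPf, hPi, hPm⟩ := hasBlockLaw_univ hC hδs hΦs
  -- All three claims depend only on the law of `Ω`, so they are transported from the probability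
  -- law `P`.
  rw [graphWishart_eq_of_blockIntegral hc0 hct hPf] at hΩ
  have hm := hΩ.map_eq
  refine ⟨hΩ.isProbabilityMeasure, fun i j => ?_, ?_⟩
  · have h := hPi i j
    rw [← hm] at h
    exact h.comp_aemeasurable hΩ.aemeasurable
  · ext i j
    rw [Matrix.of_apply, ← integral_map (f := fun M : Matrix V V ℝ => M i j) hΩ.aemeasurable
      (measurable_matrix_apply i j).aestronglyMeasurable, hm, hPm]
    rfl
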